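/- Let $A$ be a maximal dissipative operator on a complex Hilbert space $H$: $A$ is densely defined, $\Im\langle Ah,h\rangle\ge 0$ for $h\in D(A)$, and $A$ has no non-trivial dissipative extension. (Inner products are linear in the first argument.) Let $E,E_*$ be Hilbert spaces, and let $\Gamma:D(A)\to E$ and $\Gamma_*:D(A^*)\to E_*$ be linear maps that are bounded in the graph norms of $A$ and $A^*$, have dense range, and satisfy $$\langle Au,v\rangle-\langle u,Av\rangle=i\langle\Gamma u,\Gamma v\rangle_E\quad(u,v\in D(A)),\qquad \langle A^*u,v\rangle-\langle u,A^*v\rangle=-i\langle\Gamma_* u,\Gamma_* v\rangle_{E_*}\quad(u,v\in D(A^*)).$$ For $z\in\mathbb C^+$ let $S(z):E\to E_*$ be the Štraus characteristic function, i.e. the bounded operator with $S(z)\Gamma u=\Gamma_*(A^*-z)^{-1}(A-z)u$ for all $u\in D(A)$. Let $\lambda\in\mathbb C^+$ and $\mu\in\mathbb C^-$ (the open upper and lower half-planes). In $\mathcal H=L^2(\mathbb R^-,E_*)\oplus H\oplus L^2(\mathbb R^+,E)$ let $D(\mathcal L)$ be the set of all $U=(v_-,u,v_+)$ with $u\in H$,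 $v_-\in H^1(\mathbb R^-,E_*)$, $v_+\in H^1(\mathbb R^+,E)$, such that $$u+(\Gamma_*(A^*+\mu)^{-1})^*v_-(0)\in D(A),\qquad u+(\Gamma(A+\lambda)^{-1})^*v_+(0)\in D(A^*),$$ $$\text{(I)}\quad v_+(0)=S(-\mu)^*v_-(0)+i\Gamma\bigl(u+(\Gamma_*(A^*+\mu)^{-1})^*v_-(0)\bigr),$$ $$\text{(II)}\quad v_-(0)=S(-\bar\lambda)v_+(0)-i\Gamma_*\bigl(u+(\Gamma(A+\lambda)^{-1})^*v_+(0)\bigr).$$ For $U\in D(\mathcal L)$ put $$TU=A^*\bigl(u+(\Gamma(A+\lambda)^{-1})^*v_+(0)\bigr)+\bar\lambda(\Gamma(A+\lambda)^{-1})^*v_+(0),$$ $$T_*U=A\bigl(u+(\Gamma_*(A^*+\mu)^{-1})^*v_-(0)\bigr)+\bar\mu(\Gamma_*(A^*+\mu)^{-1})^*v_-(0),$$ and $\mathcal LU=(iv_-',\,TU,\,iv_+')$. Then $T=T_*$ on $D(\mathcal L)$, the operator $\mathcal L$ is selfadjoint, and $\mathcal L$ is a minimal selfadjoint dilation of $A$.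 That is, with $P_H$ the projection onto the second component, every non-real $z$ lies in the resolvent set of $\mathcal L$ and $$P_H(\mathcal L-z)^{-1}|_H=\begin{cases}(A-z)^{-1}, & z\in\mathbb C^-,\\ (A^*-z)^{-1}, & z\in\mathbb C^+,\end{cases}$$ where $z\in\rho(A)$ in the first case and $z\in\rho(A^*)$ in the second; no reducing part of $\mathcal L$ on a proper closed subspace of $\mathcal H$ containing $\{0\}\oplus H\oplus\{0\}$ is itself a selfadjoint dilation of $A$; and the closed linear span of all $(\mathcal L-z)^{-1}(0,h,0)$ with $z\notin\mathbb R$ and $h\in H$ is $\mathcal H$. -/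

import Mathlib

open MeasureTheory Set

namespace LinearPMap

section Basic

variable {X Y : Type*} [NormedAddCommGroup X] [InnerProductSpace ℂ X]
  [NormedAddCommGroup Y] [InnerProductSpace ℂ Y]

/-- A densely defined operator `A` with `Im ⟨A h, h⟩ ≥ 0` on its domain, where `⟨x, y⟩` is linear in
its first argument `x`, i.e. it is `inner ℂ y x` in Lean. -/
def IsDissipative (A : X →ₗ.[ℂ] X) : Prop :=
  Dense (A.domain : Set X) ∧ ∀ h : A.domain, 0 ≤ (inner ℂ (h : X) (A h)).im

/-- A dissipative operator without non-trivial dissipative extensions. -/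
def IsMaximalDissipative (A : X →ₗ.[ℂ] X) : Prop :=
  A.IsDissipative ∧ ∀ B : X →ₗ.[ℂ] X, B.IsDissipative → A ≤ B → B = A

/-- The operator `A - z`, as a linear map on the domain of `A`. -/
def shift (A : X →ₗ.[ℂ] X) (z : ℂ) : A.domain →ₗ[ℂ] X :=
  A.toFun - z • A.domain.subtype

/-- The set `ρ(A)` of all `z` for which `A - z` is a bijection from the domain onto the space, with
a bounded inverse. -/
def resolventSet (A : X →ₗ.[ℂ] X) : Set ℂ :=
  {z | Function.Bijective (A.shift z) ∧ ∃ C : ℝ, ∀ u : A.domain, ‖(u : X)‖ ≤ C * ‖A.shift z u‖}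

open Classical in
/-- The inverse `(A - z)⁻¹ : X → D(A)` of `A - z`; it is used only for `z ∈ ρ(A)`. -/
noncomputable def resolventMap (A : X →ₗ.[ℂ] X) (z : ℂ) : X →ₗ[ℂ] A.domain :=
  if h : Function.Bijective (A.shift z) then (LinearEquiv.ofBijective (A.shift z) h).symm else 0

/-- `Γ : D(B) → Y` is linear, bounded in the graph norm of `B`, has dense range, and satisfies
`⟨B u, v⟩ - ⟨u, B v⟩ = c ⟨Γ u, Γ v⟩` for all `u, v ∈ D(B)`. -/
structure IsLagrangeOperator (B : X →ₗ.[ℂ] X) (c : ℂ) (Γ : B.domain →ₗ[ℂ] Y) : Prop where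
  bounded : ∃ C : ℝ, ∀ u : B.domain, ‖Γ u‖ ≤ C * (‖(u : X)‖ + ‖B u‖)
  denseRange : DenseRange Γ
  lagrange : ∀ u v : B.domain,
    inner ℂ (v : X) (B u) - inner ℂ (B v) (u : X) = c * inner ℂ (Γ v) (Γ u)

open Classical in
/-- The adjoint `Y → X` of a bounded everywhere defined linear map `f : X → Y`. -/
noncomputable def boundedAdjoint [CompleteSpace X] [CompleteSpace Y] (f : X →ₗ[ℂ] Y) : Y →L[ℂ] X :=
  if h : Continuous f then ContinuousLinearMap.adjoint (⟨f, h⟩ : X →L[ℂ] Y) else 0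

/-- The bounded operator `(Γ (B - z)⁻¹)* : Y → X`, for `z ∈ ρ(B)`. -/
noncomputable def gammaField [CompleteSpace X] [CompleteSpace Y] (B : X →ₗ.[ℂ] X)
    (Γ : B.domain →ₗ[ℂ] Y) (z : ℂ) : Y →L[ℂ] X :=
  boundedAdjoint (Γ ∘ₗ B.resolventMap z)

end Basic

section Reducing

variable {K : Type*} [NormedAddCommGroup K] [InnerProductSpace ℂ K]

/-- `M` is invariant for `L`: with `P` the orthogonal projection onto `M`, one has
`P D(L) ⊆ D(L)` and `L P h ∈ M` for all `h ∈ D(L)`. -/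
def IsInvariant (L : K →ₗ.[ℂ] K) (M : Submodule ℂ K) [M.HasOrthogonalProjection] : Prop :=
  ∀ h : L.domain, ∃ hP : M.starProjection (h : K) ∈ L.domain,
    L ⟨M.starProjection (h : K), hP⟩ ∈ M

/-- `M` is reducing for `L`: both `M` and its orthogonal complement are invariant. -/
def IsReducing (L : K →ₗ.[ℂ] K) (M : Submodule ℂ K) [M.HasOrthogonalProjection] : Prop :=
  L.IsInvariant M ∧ L.IsInvariant Mᗮ

theorem IsInvariant.apply_mem {L : K →ₗ.[ℂ] K} {M : Submodule ℂ K} [M.HasOrthogonalProjection]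
    (h : L.IsInvariant M) (u : L.domain) (hu : (u : K) ∈ M) : L u ∈ M := by
  obtain ⟨hP, hM⟩ := h u
  have e : M.starProjection (u : K) = u := Submodule.starProjection_eq_self_iff.mpr hu
  have : (⟨M.starProjection (u : K), hP⟩ : L.domain) = u := Subtype.ext e
  rwa [this] at hM

/-- The part of `L` in an invariant subspace `M`: the operator on `M` with domain `D(L) ∩ M`. -/
def part (L : K →ₗ.[ℂ] K) (M : Submodule ℂ K) [M.HasOrthogonalProjection]
    (h : L.IsInvariant M) : M →ₗ.[ℂ] M where
  domain := L.domain.comap M.subtype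
  toFun :=
    { toFun := fun u => ⟨L ⟨((u : M) : K), u.2⟩, h.apply_mem _ (u : M).2⟩
      map_add' := fun u v => Subtype.ext (L.map_add ⟨((u : M) : K), u.2⟩ ⟨((v : M) : K), v.2⟩)
      map_smul' := fun c u => Subtype.ext (L.map_smul c ⟨((u : M) : K), u.2⟩) }

end Reducing

section Dilation

variable {H K : Type*} [NormedAddCommGroup H] [InnerProductSpace ℂ H] [CompleteSpace H]
  [NormedAddCommGroup K] [InnerProductSpace ℂ K]

/-- The operator `L` on `K` is a selfadjoint dilation of the operator `A` on `H`, where `H` is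
regarded as a subspace of `K` through the isometry `J`, so that the adjoint of `J` is the orthogonal
projection onto `H`: `L` is selfadjoint and `(A - z)⁻¹ = P_H (L - z)⁻¹ |_H` for `z` in the open
lower half-plane. -/
structure IsSelfadjointDilation [CompleteSpace K] (A : H →ₗ.[ℂ] H) (J : H →ₗᵢ[ℂ] K)
    (L : K →ₗ.[ℂ] K) : Prop where
  selfadjoint : IsSelfAdjoint L
  mem_resolventSet : ∀ z : ℂ, z.im < 0 → z ∈ L.resolventSet ∧ z ∈ A.resolventSet
  compression : ∀ z : ℂ, z.im < 0 → ∀ h : H,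
    ContinuousLinearMap.adjoint J.toContinuousLinearMap ((L.resolventMap z (J h) : L.domain) : K)
      = (A.resolventMap z h : A.domain)

/-- The isometry `J : H → K`, with values in the subspace `M`. -/
def isometryInto (J : H →ₗᵢ[ℂ] K) (M : Submodule ℂ K) (hJ : ∀ h, J h ∈ M) : H →ₗᵢ[ℂ] M where
  toLinearMap := J.toLinearMap.codRestrict M hJ
  norm_map' := J.norm_map

/-- A selfadjoint dilation is minimal if no reducing part of it, on a proper closed subspace that
contains `H`, is itself a selfadjoint dilation of `A`. -/
def IsMinimalSelfadjointDilation [CompleteSpace K] (A : H →ₗ.[ℂ] H) (J : H →ₗᵢ[ℂ] K)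
    (L : K →ₗ.[ℂ] K) : Prop :=
  IsSelfadjointDilation A J L ∧
    ∀ (M : Submodule ℂ K) [CompleteSpace M] (hM : L.IsReducing M) (hJ : ∀ h, J h ∈ M),
      IsSelfadjointDilation A (isometryInto J M hJ) (L.part M hM.1) → M = ⊤

end Dilation

end LinearPMap

namespace Channel

/-- `L²(s, F)`. -/
abbrev L2 (s : Set ℝ) (F : Type*) [NormedAddCommGroup F] : Type _ :=
  Lp F 2 (volume.restrict s)

theorem intervalIntegrable {s : Set ℝ} {F : Type*} [NormedAddCommGroup F] (g : L2 s F) (a b : ℝ) :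
    IntervalIntegrable g (volume.restrict s) a b := by
  rw [intervalIntegrable_iff]
  have hg : MemLp g 2 ((volume.restrict s).restrict (Set.uIoc a b)) := (Lp.memLp g).restrict _
  have : IsFiniteMeasure ((volume.restrict s).restrict (Set.uIoc a b)) := by
    constructor
    rw [Measure.restrict_apply_univ]
    refine lt_of_le_of_lt (Measure.restrict_apply_le _ _) ?_
    simp [Set.uIoc]
  exact hg.integrable (by norm_num)

/-- The set of all `(v, (e, v'))`, where `v` is a function of class `H¹` on the half-line `s`
(`s = (0, ∞)` or `s = (-∞, 0)`), i.e. `v ∈ L²(s, F)` has an absolutely continuous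
representative with derivative `v' ∈ L²(s, F)`, and `e = v(0)` is the boundary value of this
representative: `v(x) = e + ∫₀ˣ v'(t) dt` for almost every `x ∈ s`. -/
def sobolevGraph (s : Set ℝ) (F : Type*) [NormedAddCommGroup F] [NormedSpace ℂ F] :
    Submodule ℂ (L2 s F × (F × L2 s F)) where
  carrier := {p | ∀ᵐ x ∂(volume.restrict s),
    p.1 x = p.2.1 + ∫ t in (0 : ℝ)..x, p.2.2 t ∂(volume.restrict s)}
  zero_mem' := by
    have h0 := Lp.coeFn_zero F 2 (volume.restrict s)
    filter_upwards [h0] with x hx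
    have : ∫ t in (0 : ℝ)..x, (0 : L2 s F) t ∂(volume.restrict s) = 0 := by
      rw [intervalIntegral.integral_congr_ae' (g := fun _ => (0 : F))]
      · simp
      · filter_upwards [h0] with t ht _ using by simpa using ht
      · filter_upwards [h0] with t ht _ using by simpa using ht
    simp only [Prod.fst_zero, Prod.snd_zero, this, add_zero]
    simpa using hx
  add_mem' := by
    rintro ⟨v, e, g⟩ ⟨w, f, k⟩ hv hw
    simp only [Set.mem_ofPred_eq] at hv hw ⊢
    have hgk := Lp.coeFn_add g k
    filter_upwards [hv, hw, Lp.coeFn_add v w] with x h1 h2 h3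
    have : ∫ t in (0 : ℝ)..x, (g + k : L2 s F) t ∂(volume.restrict s)
        = (∫ t in (0 : ℝ)..x, g t ∂(volume.restrict s))
          + ∫ t in (0 : ℝ)..x, k t ∂(volume.restrict s) := by
      rw [← intervalIntegral.integral_add (intervalIntegrable g 0 x) (intervalIntegrable k 0 x)]
      refine intervalIntegral.integral_congr_ae' ?_ ?_
      · filter_upwards [hgk] with t ht _ using by simpa using ht
      · filter_upwards [hgk] with t ht _ using by simpa using ht
    simp only [Prod.mk_add_mk, this, h3, Pi.add_apply, h1, h2]
    abel
  smul_mem' := by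
    rintro c ⟨v, e, g⟩ hv
    simp only [Set.mem_ofPred_eq] at hv ⊢
    have hg := Lp.coeFn_smul c g
    filter_upwards [hv, Lp.coeFn_smul c v] with x h1 h3
    have : ∫ t in (0 : ℝ)..x, (c • g : L2 s F) t ∂(volume.restrict s)
        = c • ∫ t in (0 : ℝ)..x, g t ∂(volume.restrict s) := by
      rw [← intervalIntegral.integral_smul]
      refine intervalIntegral.integral_congr_ae' ?_ ?_
      · filter_upwards [hg] with t ht _ using by simpa using ht
      · filter_upwards [hg] with t ht _ using by simpa using ht
    simp only [Prod.smul_mk, this, h3, Pi.smul_apply, h1, smul_add]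

/-- The boundary value and the derivative of a function of class `H¹` are unique. -/
theorem sobolevGraph_unique {s : Set ℝ} {F : Type*} [NormedAddCommGroup F] [NormedSpace ℂ F]
    [CompleteSpace F] (hs : IsOpen s) (h0 : (0 : ℝ) ∈ closure s) :
    ∀ (p : L2 s F × (F × L2 s F)), p ∈ sobolevGraph s F → p.1 = 0 → p.2 = 0 := by
  rintro ⟨v, e, g⟩ hp rfl
  have hp' : ∀ᵐ x ∂(volume.restrict s),
    (0 : L2 s F) x = e + ∫ t in (0 : ℝ)..x, g t ∂(volume.restrict s) := hp
  have hk : LocallyIntegrable (s.indicator g) volume := by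
    intro x
    refine ⟨Set.Icc (x - 1) (x + 1), Icc_mem_nhds (by linarith) (by linarith), ?_⟩
    have h1 := intervalIntegrable g (x - 2) (x + 1)
    rw [intervalIntegrable_iff, IntegrableOn, Measure.restrict_restrict measurableSet_uIoc,
      ← IntegrableOn] at h1
    rw [integrableOn_indicator_iff hs.measurableSet]
    refine h1.mono_set ?_
    rw [Set.uIoc_of_le (by linarith)]
    rintro y ⟨hy1, hy2⟩
    exact ⟨⟨by linarith [hy2.1], hy2.2⟩, hy1⟩
  have hki : ∀ a b, IntervalIntegrable (s.indicator g) volume a b := fun a b =>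
    intervalIntegrable_iff.mpr ((LocallyIntegrable.integrableOn_isCompact hk
      isCompact_uIcc).mono_set uIoc_subset_uIcc)
  have hF : ∀ x : ℝ, ∫ t in (0 : ℝ)..x, g t ∂(volume.restrict s)
      = ∫ t in (0 : ℝ)..x, s.indicator g t := by
    intro x
    simp only [intervalIntegral, setIntegral_indicator hs.measurableSet,
      Measure.restrict_restrict measurableSet_Ioc]
  have hcont : Continuous fun x : ℝ => e + ∫ t in (0 : ℝ)..x, s.indicator g t :=
    continuous_const.add
      (intervalIntegral.continuous_primitive (fun a b => hki a b) 0)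
  have hz : ∀ᵐ x ∂(volume.restrict s), e + ∫ t in (0 : ℝ)..x, s.indicator g t = 0 := by
    filter_upwards [hp', Lp.coeFn_zero F 2 (volume.restrict s)] with x h1 h2
    rw [← hF, ← h1, h2]
    rfl
  have hall : ∀ x ∈ s, e + ∫ t in (0 : ℝ)..x, s.indicator g t = 0 :=
    Measure.eqOn_open_of_ae_eq (μ := volume) hz hs hcont.continuousOn continuousOn_const
  have hcl : closure s ⊆ {x | e + ∫ t in (0 : ℝ)..x, s.indicator g t = 0} :=
    closure_minimal hall (isClosed_eq hcont continuous_const)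
  have he : e = 0 := by simpa using hcl h0
  subst he
  have hg : ∀ᵐ x ∂(volume.restrict s), g x = 0 := by
    rw [ae_restrict_iff' hs.measurableSet]
    filter_upwards [LocallyIntegrable.ae_hasDerivAt_integral hk] with x hx hxs
    have h2 : HasDerivAt (fun y => ∫ t in (0 : ℝ)..y, s.indicator g t) 0 x := by
      refine (hasDerivAt_const x (0 : F)).congr_of_eventuallyEq ?_
      filter_upwards [hs.mem_nhds hxs] with y hy using by simpa using hall y hy
    have h3 := (hx 0).unique h2
    rwa [Set.indicator_of_mem hxs] at h3
  refine Prod.ext rfl ?_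
  refine Lp.ext ?_
  filter_upwards [hg, Lp.coeFn_zero F 2 (volume.restrict s)] with x h1 h2
  rw [h1]
  exact h2.symm

/-- The map `v ↦ (v(0), v')`, whose domain is the Sobolev space `H¹(s, F)`, on a half-line `s`. -/
noncomputable def jet (s : Set ℝ) (F : Type*) [NormedAddCommGroup F] [NormedSpace ℂ F] :
    L2 s F →ₗ.[ℂ] F × L2 s F :=
  (sobolevGraph s F).toLinearPMap

end Channel

namespace Dilation

open Channel
open scoped LinearPMap

/-- The Hilbert space `L²(ℝ⁻, Es) ⊕ H ⊕ L²(ℝ⁺, E)` of all `U = (v₋, u, v₊)`. -/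
abbrev Space (H E Es : Type*) [NormedAddCommGroup H] [NormedAddCommGroup E]
    [NormedAddCommGroup Es] : Type _ :=
  WithLp 2 (L2 (Iio 0) Es × WithLp 2 (H × L2 (Ioi 0) E))

section

variable {H E Es : Type*}
  [NormedAddCommGroup H] [InnerProductSpace ℂ H]
  [NormedAddCommGroup E] [InnerProductSpace ℂ E]
  [NormedAddCommGroup Es] [InnerProductSpace ℂ Es]

/-- The embedding `h ↦ (0, h, 0)` of `H`. -/
noncomputable def embed : H →ₗᵢ[ℂ] Space H E Es where
  toFun h := WithLp.toLp 2 (0, WithLp.toLp 2 (h, 0))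
  map_add' _ _ := by simp [← WithLp.toLp_add]
  map_smul' _ _ := by simp [← WithLp.toLp_smul]
  norm_map' _ := by simp

/-- The component `u` of `U = (v₋, u, v₊)`, as a linear map; it is the projection onto `H`. -/
noncomputable def mid : Space H E Es →ₗ[ℂ] H where
  toFun U := U.snd.fst
  map_add' _ _ := rfl
  map_smul' _ _ := rfl

/-- The subspace of all `(v₋, u, v₊)` with `v₋ ∈ H¹(ℝ⁻, Es)` and `v₊ ∈ H¹(ℝ⁺, E)`. -/
noncomputable def channelDomain (H E Es : Type*)
    [NormedAddCommGroup H] [InnerProductSpace ℂ H]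
    [NormedAddCommGroup E] [InnerProductSpace ℂ E]
    [NormedAddCommGroup Es] [InnerProductSpace ℂ Es] : Submodule ℂ (Space H E Es) where
  carrier := {U | U.fst ∈ (jet (Iio 0) Es).domain ∧ U.snd.snd ∈ (jet (Ioi 0) E).domain}
  zero_mem' := ⟨Submodule.zero_mem _, Submodule.zero_mem _⟩
  add_mem' h k := ⟨Submodule.add_mem _ h.1 k.1, Submodule.add_mem _ h.2 k.2⟩
  smul_mem' c _ h := ⟨Submodule.smul_mem _ c h.1, Submodule.smul_mem _ c h.2⟩

/-- `U ↦ (v₋(0), v₋')`. -/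
noncomputable def jetMinus : channelDomain H E Es →ₗ[ℂ] Es × L2 (Iio 0) Es where
  toFun U := jet (Iio 0) Es ⟨(U : Space H E Es).fst, U.2.1⟩
  map_add' U V := (jet (Iio 0) Es).map_add
    ⟨(U : Space H E Es).fst, U.2.1⟩ ⟨(V : Space H E Es).fst, V.2.1⟩
  map_smul' c U := (jet (Iio 0) Es).map_smul c ⟨(U : Space H E Es).fst, U.2.1⟩

/-- `U ↦ (v₊(0), v₊')`. -/
noncomputable def jetPlus : channelDomain H E Es →ₗ[ℂ] E × L2 (Ioi 0) E where
  toFun U := jet (Ioi 0) E ⟨(U : Space H E Es).snd.snd, U.2.2⟩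
  map_add' U V := (jet (Ioi 0) E).map_add
    ⟨(U : Space H E Es).snd.snd, U.2.2⟩ ⟨(V : Space H E Es).snd.snd, V.2.2⟩
  map_smul' c U := (jet (Ioi 0) E).map_smul c ⟨(U : Space H E Es).snd.snd, U.2.2⟩

/-- `U ↦ v₋(0)`. -/
noncomputable def bdryMinus : channelDomain H E Es →ₗ[ℂ] Es :=
  LinearMap.fst ℂ Es (L2 (Iio 0) Es) ∘ₗ jetMinus

/-- `U ↦ v₊(0)`. -/
noncomputable def bdryPlus : channelDomain H E Es →ₗ[ℂ] E :=
  LinearMap.fst ℂ E (L2 (Ioi 0) E) ∘ₗ jetPlus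

/-- `U ↦ v₋'`. -/
noncomputable def derivMinus : channelDomain H E Es →ₗ[ℂ] L2 (Iio 0) Es :=
  LinearMap.snd ℂ Es (L2 (Iio 0) Es) ∘ₗ jetMinus

/-- `U ↦ v₊'`. -/
noncomputable def derivPlus : channelDomain H E Es →ₗ[ℂ] L2 (Ioi 0) E :=
  LinearMap.snd ℂ E (L2 (Ioi 0) E) ∘ₗ jetPlus

variable [CompleteSpace H] [CompleteSpace E] [CompleteSpace Es]
  (A : H →ₗ.[ℂ] H) (Γ : A.domain →ₗ[ℂ] E) (Γs : A†.domain →ₗ[ℂ] Es) (lam mu : ℂ)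

open Classical in
/-- The Štraus characteristic function `S(z) : E → Es`: the bounded operator with
`S(z) Γ u = Γs (A* - z)⁻¹ (A - z) u` for all `u ∈ D(A)`, unique as `Γ` has dense
range; for maximal dissipative `A` it exists whenever `z ∈ ρ(A*)`, e.g. for `Im z > 0`. -/
noncomputable def straus (z : ℂ) : E →L[ℂ] Es :=
  if h : ∃ S : E →L[ℂ] Es, ∀ u : A.domain, S (Γ u) = Γs (A†.resolventMap z (A.shift z u))
  then h.choose else 0

/-- `U ↦ u + (Γs (A* + μ)⁻¹)* v₋(0)`. -/
noncomputable def liftMinus : channelDomain H E Es →ₗ[ℂ] H :=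
  mid ∘ₗ (channelDomain H E Es).subtype + (A†.gammaField Γs (-mu)).toLinearMap ∘ₗ bdryMinus

/-- `U ↦ u + (Γ (A + λ)⁻¹)* v₊(0)`. -/
noncomputable def liftPlus : channelDomain H E Es →ₗ[ℂ] H :=
  mid ∘ₗ (channelDomain H E Es).subtype + (A.gammaField Γ (-lam)).toLinearMap ∘ₗ bdryPlus

/-- The defining conditions of the domain of the dilation, for `U = (v₋, u, v₊)` with `v₋`, `v₊` of
class `H¹`. -/
structure DomainCond (U : channelDomain H E Es) : Prop where
  mem_domain : liftMinus A Γs mu U ∈ A.domain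
  mem_adjoint_domain : liftPlus A Γ lam U ∈ A†.domain
  condI : bdryPlus U = ContinuousLinearMap.adjoint (straus A Γ Γs (-mu)) (bdryMinus U)
    + Complex.I • Γ ⟨liftMinus A Γs mu U, mem_domain⟩
  condII : bdryMinus U = straus A Γ Γs (-star lam) (bdryPlus U)
    - Complex.I • Γs ⟨liftPlus A Γ lam U, mem_adjoint_domain⟩

variable {A Γ Γs lam mu}

theorem DomainCond.zero : DomainCond A Γ Γs lam mu 0 where
  mem_domain := by simp
  mem_adjoint_domain := by simp
  condI := by
    have : ∀ h, (⟨liftMinus A Γs mu (0 : channelDomain H E Es), h⟩ : A.domain) = 0 :=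
      fun _ => Subtype.ext (map_zero (liftMinus (E := E) A Γs mu))
    rw [this]
    simp
  condII := by
    have : ∀ h, (⟨liftPlus A Γ lam (0 : channelDomain H E Es), h⟩ : A†.domain) = 0 :=
      fun _ => Subtype.ext (map_zero (liftPlus (Es := Es) A Γ lam))
    rw [this]
    simp

theorem DomainCond.add {U V : channelDomain H E Es} (hU : DomainCond A Γ Γs lam mu U)
    (hV : DomainCond A Γ Γs lam mu V) : DomainCond A Γ Γs lam mu (U + V) where
  mem_domain := by
    rw [map_add]
    exact A.domain.add_mem hU.mem_domain hV.mem_domain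
  mem_adjoint_domain := by
    rw [map_add]
    exact A†.domain.add_mem hU.mem_adjoint_domain hV.mem_adjoint_domain
  condI := by
    have : ∀ h, (⟨liftMinus A Γs mu (U + V), h⟩ : A.domain)
        = ⟨liftMinus A Γs mu U, hU.mem_domain⟩ + ⟨liftMinus A Γs mu V, hV.mem_domain⟩ :=
      fun _ => Subtype.ext (map_add _ _ _)
    rw [this, map_add, map_add, map_add, map_add, hU.condI, hV.condI, smul_add]
    abel
  condII := by
    have : ∀ h, (⟨liftPlus A Γ lam (U + V), h⟩ : A†.domain)
        = ⟨liftPlus A Γ lam U, hU.mem_adjoint_domain⟩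
          + ⟨liftPlus A Γ lam V, hV.mem_adjoint_domain⟩ :=
      fun _ => Subtype.ext (map_add _ _ _)
    rw [this, map_add, map_add, map_add, map_add, hU.condII, hV.condII, smul_add]
    abel

theorem DomainCond.smul {U : channelDomain H E Es} (c : ℂ) (hU : DomainCond A Γ Γs lam mu U) :
    DomainCond A Γ Γs lam mu (c • U) where
  mem_domain := by
    rw [map_smul]
    exact A.domain.smul_mem c hU.mem_domain
  mem_adjoint_domain := by
    rw [map_smul]
    exact A†.domain.smul_mem c hU.mem_adjoint_domain
  condI := by
    have : ∀ h, (⟨liftMinus A Γs mu (c • U), h⟩ : A.domain)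
        = c • ⟨liftMinus A Γs mu U, hU.mem_domain⟩ :=
      fun _ => Subtype.ext (map_smul _ _ _)
    rw [this, map_smul, map_smul, map_smul, map_smul, hU.condI, smul_add, smul_comm c Complex.I]
  condII := by
    have : ∀ h, (⟨liftPlus A Γ lam (c • U), h⟩ : A†.domain)
        = c • ⟨liftPlus A Γ lam U, hU.mem_adjoint_domain⟩ :=
      fun _ => Subtype.ext (map_smul _ _ _)
    rw [this, map_smul, map_smul, map_smul, map_smul, hU.condII, smul_sub, smul_comm c Complex.I]

variable (A Γ Γs lam mu)

/-- The domain of the dilation. -/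
noncomputable def domain : Submodule ℂ (Space H E Es) where
  carrier := {U | ∃ h : U ∈ channelDomain H E Es, DomainCond A Γ Γs lam mu ⟨U, h⟩}
  zero_mem' := ⟨Submodule.zero_mem _, DomainCond.zero⟩
  add_mem' := fun ⟨h, hU⟩ ⟨k, hV⟩ => ⟨Submodule.add_mem _ h k, hU.add hV⟩
  smul_mem' := fun c _ ⟨h, hU⟩ => ⟨Submodule.smul_mem _ c h, hU.smul c⟩

/-- An element of the domain, as a vector with components `v₋`, `v₊` of class `H¹`. -/
noncomputable def toChannel : domain A Γ Γs lam mu →ₗ[ℂ] channelDomain H E Es :=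
  Submodule.inclusion fun _ h => h.1

/-- `U ↦ u + (Γs (A* + μ)⁻¹)* v₋(0)`, as a map into `D(A)`. -/
noncomputable def domainMinus : domain A Γ Γs lam mu →ₗ[ℂ] A.domain :=
  (liftMinus A Γs mu ∘ₗ toChannel A Γ Γs lam mu).codRestrict A.domain fun U => U.2.2.mem_domain

/-- `U ↦ u + (Γ (A + λ)⁻¹)* v₊(0)`, as a map into `D(A*)`. -/
noncomputable def domainPlus : domain A Γ Γs lam mu →ₗ[ℂ] A†.domain :=
  (liftPlus A Γ lam ∘ₗ toChannel A Γ Γs lam mu).codRestrict A†.domain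
    fun U => U.2.2.mem_adjoint_domain

/-- `T U = A* (u + (Γ (A + λ)⁻¹)* v₊(0)) + conj λ (Γ (A + λ)⁻¹)* v₊(0)`. -/
noncomputable def opT : domain A Γ Γs lam mu →ₗ[ℂ] H :=
  A†.toFun ∘ₗ domainPlus A Γ Γs lam mu
    + star lam • (A.gammaField Γ (-lam)).toLinearMap ∘ₗ bdryPlus ∘ₗ toChannel A Γ Γs lam mu

/-- `T_* U = A (u + (Γs (A* + μ)⁻¹)* v₋(0)) + conj μ (Γs (A* + μ)⁻¹)* v₋(0)`. -/
noncomputable def opTstar : domain A Γ Γs lam mu →ₗ[ℂ] H :=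
  A.toFun ∘ₗ domainMinus A Γ Γs lam mu
    + star mu • (A†.gammaField Γs (-mu)).toLinearMap ∘ₗ bdryMinus ∘ₗ toChannel A Γ Γs lam mu

/-- The operator `U ↦ (i v₋', T U, i v₊')`. -/
noncomputable def operator : Space H E Es →ₗ.[ℂ] Space H E Es where
  domain := domain A Γ Γs lam mu
  toFun :=
    { toFun := fun U => WithLp.toLp 2 (Complex.I • derivMinus (toChannel A Γ Γs lam mu U),
        WithLp.toLp 2 (opT A Γ Γs lam mu U,
          Complex.I • derivPlus (toChannel A Γ Γs lam mu U)))
      map_add' := by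
        intro U V
        simp only [map_add, smul_add, ← WithLp.toLp_add, Prod.mk_add_mk]
      map_smul' := by
        intro c U
        simp only [map_smul, smul_comm Complex.I c, ← WithLp.toLp_smul, Prod.smul_mk,
          RingHom.id_apply] }

end

end Dilation

/-!
Let `L` be the operator in question, and write `e₋`, `e₊` for the boundary values `v₋(0)`, `v₊(0)`.
Consider the linear relation

  `R₀ = {((x + i y, A x + i A* y), (Γs y, i Γ x)) : x ∈ D(A), y ∈ D(A*)}`.

The heart of the proof is that each of the two descriptions of the domain of `L`, by (I) and `T_*`
with the parameter `μ`, and by (II) and `T` with the parameter `λ`, says exactly that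
`((u, f), (e₋, e₊))` belongs to the closure of `R₀`, where `f` is the component in `H` of the image
(`LinearPMap.mem_closure_coupling_iff`). Indeed the first description amounts to the graph of a
bounded operator `(f + conj μ u, e₋) ↦ (u, e₊)`, which is closed; and on the dense set where
`e₋ = Γs y` the formulas for `(Γs (A* + μ)⁻¹)* Γs y` and `S(-μ)* Γs y` show that this graph
restricts to `R₀`. The second description is the same statement with `A` and `A*` exchanged. Hence
the two descriptions agree, `T = T_*`, and nothing depends on `λ` and `μ`, so that these may be
chosen to suit a given spectral parameter `z`.

On `R₀`, and so on its closure, `2 Im ⟨f, u⟩ = ‖e₊‖² - ‖e₋‖²`. Together with Green's formula on the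
half-lines this makes `L` symmetric. Given `z` with `Im z < 0`, the equation `(L - z) U = W` is
solved in the order `v₋`, then `u` and `e₊` from the boundary relation with `μ = -conj z`, then `v₊`;
for `Im z > 0` the order is reversed. So all `L - z` are onto and `L` is selfadjoint. In particular
`(L - z)⁻¹ (0, (A - z) x, 0) = (0, x, exp(-i z ·) i Γ x)` for `Im z < 0`, which is the dilation
property. If `V = (a, b, c)` is orthogonal to all these vectors, then `z → -i ∞` gives `b ⊥ D(A)`,
hence `b = 0`; then `c` is orthogonal to all exponentials, and `c = 0` by injectivity of the Fourier
transform. The half-plane `Im z > 0` gives `a = 0` likewise. Finally a closed reducing subspace that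
contains `H` contains `(L - z)⁻¹ H`, hence is everything.

The equation on a half-line is solved without an explicit formula: Green's formula bounds
`v ↦ v' + κ v` from below, so its range is closed, and the range contains exponentials, which are
complete.
-/

namespace LinearPMap

variable {X Y : Type*} [NormedAddCommGroup X] [InnerProductSpace ℂ X]
  [NormedAddCommGroup Y] [InnerProductSpace ℂ Y]

/-! ### Resolvents -/

theorem shift_apply (A : X →ₗ.[ℂ] X) (z : ℂ) (u : A.domain) :
    A.shift z u = A u - z • (u : X) := rfl

theorem shift_resolventMap {A : X →ₗ.[ℂ] X} {z : ℂ} (hz : z ∈ A.resolventSet) (h : X) :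
    A.shift z (A.resolventMap z h) = h := by
  rw [resolventMap, dif_pos hz.1]
  exact (LinearEquiv.ofBijective (A.shift z) hz.1).apply_symm_apply h

theorem resolventMap_shift {A : X →ₗ.[ℂ] X} {z : ℂ} (hz : z ∈ A.resolventSet) (u : A.domain) :
    A.resolventMap z (A.shift z u) = u :=
  hz.1.1 (shift_resolventMap hz _)

theorem apply_resolventMap {A : X →ₗ.[ℂ] X} {z : ℂ} (hz : z ∈ A.resolventSet) (h : X) :
    A (A.resolventMap z h) = h + z • (A.resolventMap z h : X) := by
  have := shift_resolventMap hz h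
  rw [shift_apply] at this
  exact sub_eq_iff_eq_add.mp this

theorem resolventMap_eq_of_shift_eq {A : X →ₗ.[ℂ] X} {z : ℂ} (hz : z ∈ A.resolventSet)
    {u : A.domain} {h : X} (hu : A.shift z u = h) : A.resolventMap z h = u := by
  rw [← hu, resolventMap_shift hz]

theorem resolventMap_eq_of_mem_graph {A : X →ₗ.[ℂ] X} {z : ℂ} (hz : z ∈ A.resolventSet)
    {u f : X} (h : (u, f + z • u) ∈ A.graph) : (A.resolventMap z f : X) = u := by
  obtain ⟨v, rfl, h2⟩ := (mem_graph_iff A).mp h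
  rw [resolventMap_eq_of_shift_eq hz (u := v)]
  rw [shift_apply, h2, add_sub_cancel_right]

theorem surjective_shift_of_mem_graph {A : X →ₗ.[ℂ] X} {z : ℂ}
    (h : ∀ f, ∃ u, (u, f + z • u) ∈ A.graph) : Function.Surjective (A.shift z) := by
  intro f
  obtain ⟨u, hu⟩ := h f
  obtain ⟨v, rfl, h2⟩ := (mem_graph_iff A).mp hu
  exact ⟨v, by rw [shift_apply, h2, add_sub_cancel_right]⟩

theorem exists_norm_resolventMap_le {A : X →ₗ.[ℂ] X} {z : ℂ} (hz : z ∈ A.resolventSet) :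
    ∃ C : ℝ, ∀ h, ‖(A.resolventMap z h : X)‖ ≤ C * ‖h‖ := by
  obtain ⟨C, hC⟩ := hz.2
  refine ⟨C, fun h => ?_⟩
  simpa only [shift_resolventMap hz] using hC (A.resolventMap z h)

theorem continuous_resolventMap {A : X →ₗ.[ℂ] X} {z : ℂ} (hz : z ∈ A.resolventSet) :
    Continuous fun h => (A.resolventMap z h : X) := by
  obtain ⟨C, hC⟩ := exists_norm_resolventMap_le hz
  exact AddMonoidHomClass.continuous_of_bound (A.domain.subtype ∘ₗ A.resolventMap z) C hC

theorem IsLagrangeOperator.continuous_comp_resolventMap {B : X →ₗ.[ℂ] X} {c : ℂ}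
    {Γ : B.domain →ₗ[ℂ] Y} (hΓ : B.IsLagrangeOperator c Γ) {z : ℂ} (hz : z ∈ B.resolventSet) :
    Continuous (Γ ∘ₗ B.resolventMap z) := by
  obtain ⟨C, hC⟩ := hΓ.bounded
  obtain ⟨D, hD⟩ := exists_norm_resolventMap_le hz
  refine AddMonoidHomClass.continuous_of_bound (Γ ∘ₗ B.resolventMap z)
    (|C| * (D + (1 + ‖z‖ * D))) fun h => ?_
  have h1 : ‖B (B.resolventMap z h)‖ ≤ ‖h‖ + ‖z‖ * (D * ‖h‖) := by
    rw [apply_resolventMap hz]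
    refine (norm_add_le _ _).trans ?_
    rw [norm_smul]
    gcongr
    exact hD h
  calc ‖Γ (B.resolventMap z h)‖
      ≤ C * (‖(B.resolventMap z h : X)‖ + ‖B (B.resolventMap z h)‖) := hC _
    _ ≤ |C| * (‖(B.resolventMap z h : X)‖ + ‖B (B.resolventMap z h)‖) := by
        gcongr
        exact le_abs_self C
    _ ≤ |C| * (D * ‖h‖ + (‖h‖ + ‖z‖ * (D * ‖h‖))) := by
        gcongr
        exact hD h
    _ = _ := by ring

/-- The adjoint of `Γ (B - z)⁻¹`, characterised by its inner products. -/
theorem IsLagrangeOperator.inner_gammaField [CompleteSpace X] [CompleteSpace Y]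
    {B : X →ₗ.[ℂ] X} {c : ℂ} {Γ : B.domain →ₗ[ℂ] Y} (hΓ : B.IsLagrangeOperator c Γ) {z : ℂ}
    (hz : z ∈ B.resolventSet) (h : X) (e : Y) :
    inner ℂ h (B.gammaField Γ z e) = inner ℂ (Γ (B.resolventMap z h)) e := by
  rw [gammaField, boundedAdjoint, dif_pos (hΓ.continuous_comp_resolventMap hz),
    ContinuousLinearMap.adjoint_inner_right]
  rfl

theorem inner_self_eq_ofReal (x : X) : inner ℂ x x = ((‖x‖ ^ 2 : ℝ) : ℂ) := by
  rw [inner_self_eq_norm_sq_to_K]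
  norm_cast

theorem im_inner_shift (A : X →ₗ.[ℂ] X) (z : ℂ) (u : A.domain) :
    (inner ℂ (u : X) (A.shift z u)).im = (inner ℂ (u : X) (A u)).im - z.im * ‖(u : X)‖ ^ 2 := by
  rw [shift_apply, inner_sub_right, inner_smul_right, inner_self_eq_ofReal, Complex.sub_im,
    Complex.im_mul_ofReal]

theorem mul_norm_le_of_mul_sq_le {c : ℝ} {u f : X}
    (h : c * ‖u‖ ^ 2 ≤ |(inner ℂ u f).im|) : c * ‖u‖ ≤ ‖f‖ := by
  have h1 : |(inner ℂ u f).im| ≤ ‖u‖ * ‖f‖ :=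
    (Complex.abs_im_le_norm _).trans (norm_inner_le_norm u f)
  rcases (norm_nonneg u).eq_or_lt with h0 | h0
  · rw [← h0, mul_zero]
    exact norm_nonneg f
  · refine le_of_mul_le_mul_left ?_ h0
    nlinarith

theorem injective_shift_of_bound {A : X →ₗ.[ℂ] X} {z : ℂ} {c : ℝ} (hc : 0 < c)
    (h : ∀ u : A.domain, c * ‖(u : X)‖ ≤ ‖A.shift z u‖) : Function.Injective (A.shift z) := by
  rw [← LinearMap.ker_eq_bot, LinearMap.ker_eq_bot']
  intro u hu
  have := h u
  rw [hu, norm_zero] at this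
  have h0 : ‖(u : X)‖ = 0 := by nlinarith [norm_nonneg (u : X)]
  exact Subtype.ext (norm_eq_zero.mp h0)

theorem mem_resolventSet_of_bound {A : X →ₗ.[ℂ] X} {z : ℂ} {c : ℝ} (hc : 0 < c)
    (h : ∀ u : A.domain, c * ‖(u : X)‖ ≤ ‖A.shift z u‖)
    (hs : Function.Surjective (A.shift z)) : z ∈ A.resolventSet := by
  refine ⟨⟨injective_shift_of_bound hc h, hs⟩, c⁻¹, fun u => ?_⟩
  rw [inv_mul_eq_div, le_div_iff₀' hc]
  exact h u

/-! ### Maximal dissipative operators -/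

theorem IsDissipative.bound {A : X →ₗ.[ℂ] X} (hA : A.IsDissipative) {z : ℂ}
    (u : A.domain) : -z.im * ‖(u : X)‖ ≤ ‖A.shift z u‖ := by
  apply mul_norm_le_of_mul_sq_le
  rw [im_inner_shift]
  refine le_trans ?_ (le_abs_self _)
  linarith [hA.2 u]

theorem IsDissipative.im_nonneg_of_mem_closure {A : X →ₗ.[ℂ] X} (hA : A.IsDissipative)
    {p : X × X} (hp : p ∈ A.graph.topologicalClosure) : 0 ≤ (inner ℂ p.1 p.2).im := by
  have hcl : _root_.IsClosed {p : X × X | 0 ≤ (inner ℂ p.1 p.2).im} :=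
    isClosed_le continuous_const (Complex.continuous_im.comp (by fun_prop))
  refine closure_minimal ?_ hcl hp
  intro q hq
  obtain ⟨u, h1, h2⟩ := (mem_graph_iff A).mp hq
  simpa only [mem_ofPred_eq, ← h1, ← h2] using hA.2 u

/-- A dissipative operator is closable: the closure of its graph is still dissipative, and if it
contains `(0, g)`, then perturbing `(v, A v)` by multiples of `(0, g)` forces `⟨v, g⟩ = 0`. -/
theorem IsDissipative.eq_zero_of_mem_closure {A : X →ₗ.[ℂ] X} (hA : A.IsDissipative)
    {g : X} (hg : ((0 : X), g) ∈ A.graph.topologicalClosure) : g = 0 := by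
  refine hA.1.eq_zero_of_inner_right ℂ fun v hv => ?_
  set q := inner ℂ v g with hq
  by_contra hne
  have hpos : 0 < Complex.normSq q := Complex.normSq_pos.mpr hne
  have key : ∀ s : ℝ, s * Complex.normSq q ≤ (inner ℂ v (A ⟨v, hv⟩)).im := by
    intro s
    have hmem : (v, A ⟨v, hv⟩ + (-(Complex.I * s * star q)) • g) ∈ A.graph.topologicalClosure := by
      have h1 := A.graph.topologicalClosure.add_mem
        (A.graph.le_topologicalClosure (A.mem_graph ⟨v, hv⟩))
        (A.graph.topologicalClosure.smul_mem (-(Complex.I * s * star q)) hg)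
      simpa using h1
    have h2 := hA.im_nonneg_of_mem_closure hmem
    simp only [inner_add_right, inner_smul_right, ← hq] at h2
    have h3 : -(Complex.I * s * star q) * q = -(Complex.I * ((s * Complex.normSq q : ℝ) : ℂ)) := by
      have : star q * q = (Complex.normSq q : ℂ) := by
        rw [mul_comm]; exact Complex.mul_conj q
      push_cast
      linear_combination (-Complex.I * s) * this
    rw [h3] at h2
    simp only [Complex.add_im, Complex.neg_im, Complex.mul_im, Complex.I_re, Complex.I_im,
      Complex.ofReal_re, Complex.ofReal_im] at h2
    linarith
  have := key (((inner ℂ v (A ⟨v, hv⟩)).im + 1) / Complex.normSq q)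
  rw [div_mul_cancel₀ _ hpos.ne'] at this
  linarith

theorem IsMaximalDissipative.isClosed_graph {A : X →ₗ.[ℂ] X} (hA : A.IsMaximalDissipative) :
    _root_.IsClosed (A.graph : Set (X × X)) := by
  set B := A.graph.topologicalClosure.toLinearPMap
  have hB : B.graph = A.graph.topologicalClosure := by
    refine Submodule.toLinearPMap_graph_eq _ ?_
    rintro ⟨x, g⟩ hx rfl
    exact hA.1.eq_zero_of_mem_closure hx
  have hle : A ≤ B := le_of_le_graph (hB ▸ A.graph.le_topologicalClosure)
  have hd : B.IsDissipative :=
    ⟨hA.1.1.mono hle.1, fun h => hA.1.im_nonneg_of_mem_closure (hB ▸ B.mem_graph h)⟩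
  rw [← hA.2 B hd hle, hB]
  exact A.graph.isClosed_topologicalClosure

/-- If `h ≠ 0` were orthogonal to the range of `A - z`, then `A` could be extended by
`h ↦ conj z • h` to a dissipative operator. -/
theorem IsMaximalDissipative.orthogonal_range_shift {A : X →ₗ.[ℂ] X} (hA : A.IsMaximalDissipative)
    {z : ℂ} (hz : z.im < 0) : (LinearMap.range (A.shift z))ᗮ = ⊥ := by
  rw [Submodule.eq_bot_iff]
  intro h hh
  have horth : ∀ u : A.domain, inner ℂ h (A u) = z * inner ℂ h (u : X) := by
    intro u
    have := Submodule.inner_left_of_mem_orthogonal (LinearMap.mem_range_self (A.shift z) u) hh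
    rw [shift_apply, inner_sub_right, inner_smul_right] at this
    exact sub_eq_zero.mp this
  by_contra hne
  have hpos : 0 < ‖h‖ ^ 2 := by positivity
  have hdom : h ∉ A.domain := by
    intro hd
    have h1 := hA.1.2 ⟨h, hd⟩
    rw [horth ⟨h, hd⟩, inner_self_eq_ofReal, Complex.im_mul_ofReal] at h1
    nlinarith
  set B := A.supSpanSingleton h (star z • h) hdom
  have hle : A ≤ B :=
    ⟨le_sup_left, fun x y hxy => by
      obtain ⟨x, hx⟩ := x
      obtain ⟨y, hy⟩ := y
      obtain rfl : x = y := hxy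
      exact (supSpanSingleton_apply_mk_of_mem A _ hdom hx).symm⟩
  have hd : B.IsDissipative := by
    refine ⟨hA.1.1.mono hle.1, ?_⟩
    rintro ⟨w, hw⟩
    obtain ⟨x, hx, _, hy, rfl⟩ := Submodule.mem_sup.mp hw
    obtain ⟨c, rfl⟩ := Submodule.mem_span_singleton.mp hy
    have hB : B ⟨x + c • h, hw⟩ = A ⟨x, hx⟩ + c • star z • h :=
      supSpanSingleton_apply_mk A h (star z • h) hdom x hx c
    rw [hB]
    have e1 := horth ⟨x, hx⟩
    have e2 : inner ℂ x h = star (inner ℂ h x) := (inner_conj_symm x h).symm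
    have e3 := inner_self_eq_ofReal h
    have e4 := hA.1.2 ⟨x, hx⟩
    simp only [inner_add_left, inner_add_right, inner_smul_left, inner_smul_right, e1, e2, e3]
    simp only [Complex.add_im, Complex.add_re, Complex.mul_im, Complex.mul_re, Complex.star_def,
      Complex.conj_re,
      Complex.conj_im, Complex.ofReal_re, Complex.ofReal_im]
    have : 0 ≤ (c.re ^ 2 + c.im ^ 2) * (-z.im) * ‖h‖ ^ 2 :=
      mul_nonneg (mul_nonneg (by positivity) (by linarith)) hpos.le
    nlinarith
  have hBA := hA.2 B hd hle
  apply hdom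
  rw [← hBA]
  exact Submodule.mem_sup_right (Submodule.mem_span_singleton_self h)

theorem IsMaximalDissipative.isClosed_range_shift [CompleteSpace X] {A : X →ₗ.[ℂ] X}
    (hA : A.IsMaximalDissipative) {z : ℂ} (hz : z.im < 0) :
    _root_.IsClosed (LinearMap.range (A.shift z) : Set X) := by
  have : CompleteSpace A.graph := hA.isClosed_graph.completeSpace_coe
  let T : X × X →L[ℂ] X :=
    ContinuousLinearMap.snd ℂ X X - z • ContinuousLinearMap.fst ℂ X X
  let S : A.graph →L[ℂ] X := T ∘L A.graph.subtypeL
  have hST : ∀ u : A.domain, S ⟨_, A.mem_graph u⟩ = A.shift z u := fun u => rfl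
  have hbd : ∀ p : A.graph, ‖p‖ ≤ (Real.toNNReal ((-z.im)⁻¹ + (1 + ‖z‖ * (-z.im)⁻¹)) : ℝ)
      * ‖S p‖ := by
    rintro ⟨p, hp⟩
    obtain ⟨u, h1, h2⟩ := (mem_graph_iff A).mp hp
    obtain rfl : p = ((u : X), A u) := Prod.ext h1.symm h2.symm
    rw [hST]
    have hz' : 0 < (-z.im)⁻¹ := by simpa using hz
    have hu : ‖(u : X)‖ ≤ (-z.im)⁻¹ * ‖A.shift z u‖ := by
      rw [inv_mul_eq_div, le_div_iff₀' (by linarith)]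
      exact hA.1.bound u
    have hAu : ‖A u‖ ≤ (1 + ‖z‖ * (-z.im)⁻¹) * ‖A.shift z u‖ := by
      have : A u = A.shift z u + z • (u : X) := by rw [shift_apply]; abel
      calc ‖A u‖ = ‖A.shift z u + z • (u : X)‖ := by rw [← this]
        _ ≤ ‖A.shift z u‖ + ‖z‖ * ‖(u : X)‖ := (norm_add_le _ _).trans_eq (by rw [norm_smul])
        _ ≤ ‖A.shift z u‖ + ‖z‖ * ((-z.im)⁻¹ * ‖A.shift z u‖) := by gcongr
        _ = _ := by ring
    have hn := norm_nonneg (A.shift z u)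
    rw [Real.coe_toNNReal _ (by positivity), add_mul]
    refine max_le (hu.trans ?_) (hAu.trans ?_)
    · exact le_add_of_nonneg_right (by positivity)
    · exact le_add_of_nonneg_left (by positivity)
  have hcl := (AddMonoidHomClass.antilipschitz_of_bound S hbd).isClosed_range S.uniformContinuous
  convert hcl using 1
  ext f
  constructor
  · rintro ⟨u, rfl⟩
    exact ⟨_, hST u⟩
  · rintro ⟨⟨p, hp⟩, rfl⟩
    obtain ⟨u, h1, h2⟩ := (mem_graph_iff A).mp hp
    obtain rfl : p = ((u : X), A u) := Prod.ext h1.symm h2.symm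
    exact ⟨u, (hST u).symm⟩

/-- The open lower half-plane belongs to the resolvent set of a maximal dissipative operator. -/
theorem IsMaximalDissipative.mem_resolventSet [CompleteSpace X] {A : X →ₗ.[ℂ] X}
    (hA : A.IsMaximalDissipative) {z : ℂ} (hz : z.im < 0) : z ∈ A.resolventSet := by
  refine mem_resolventSet_of_bound (neg_pos.mpr hz) (hA.1.bound) ?_
  have : CompleteSpace (LinearMap.range (A.shift z)) :=
    (hA.isClosed_range_shift hz).completeSpace_coe
  rw [← LinearMap.range_eq_top, ← Submodule.orthogonal_eq_bot_iff]
  exact hA.orthogonal_range_shift hz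

/-- The resolvent set of the adjoint is the complex conjugate of the resolvent set: `(A* - z̄)⁻¹` is
the adjoint of `(A - z)⁻¹`. -/
theorem star_mem_resolventSet_adjoint [CompleteSpace X] {A : X →ₗ.[ℂ] X}
    (hA : Dense (A.domain : Set X)) {z : ℂ} (hz : z ∈ A.resolventSet) :
    star z ∈ A.adjoint.resolventSet := by
  have hfa := adjoint_isFormalAdjoint hA
  let R : X →L[ℂ] X := ⟨A.domain.subtype ∘ₗ A.resolventMap z, continuous_resolventMap hz⟩
  have hR : ∀ h, R h = (A.resolventMap z h : X) := fun _ => rfl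
  have hinj : Function.Injective (A.adjoint.shift (star z)) := by
    rw [← LinearMap.ker_eq_bot, LinearMap.ker_eq_bot']
    intro v hv
    refine Subtype.ext (ext_inner_right ℂ fun h => ?_)
    have h1 : inner ℂ (A.adjoint v) (A.resolventMap z h : X)
        = inner ℂ (v : X) (A (A.resolventMap z h)) := hfa v _
    rw [apply_resolventMap hz, inner_add_right, inner_smul_right] at h1
    rw [shift_apply, sub_eq_zero] at hv
    rw [hv, inner_smul_left, Complex.star_def, Complex.conj_conj] at h1
    simpa using h1
  have hex : ∀ h, ∃ v : A.adjoint.domain, (v : X) = ContinuousLinearMap.adjoint R h ∧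
      A.adjoint.shift (star z) v = h := by
    intro h
    have hw : ∀ x : A.domain, inner ℂ (h + star z • ContinuousLinearMap.adjoint R h) (x : X)
        = inner ℂ (ContinuousLinearMap.adjoint R h) (A x) := by
      intro x
      have h1 : A x = A.shift z x + z • (x : X) := by rw [shift_apply]; abel
      rw [h1, inner_add_right, ContinuousLinearMap.adjoint_inner_left, hR, resolventMap_shift hz,
        inner_add_left, inner_smul_left, inner_smul_right, Complex.star_def, Complex.conj_conj]
    refine ⟨⟨_, mem_adjoint_domain_of_exists _ ⟨_, hw⟩⟩, rfl, ?_⟩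
    rw [shift_apply, adjoint_apply_eq hA _ hw, add_sub_cancel_right]
  refine ⟨⟨hinj, fun h => (hex h).imp fun v hv => hv.2⟩, ‖ContinuousLinearMap.adjoint R‖,
    fun v => ?_⟩
  obtain ⟨w, hw1, hw2⟩ := hex (A.adjoint.shift (star z) v)
  obtain rfl : w = v := hinj hw2
  calc ‖(w : X)‖ = ‖ContinuousLinearMap.adjoint R (A.adjoint.shift (star z) w)‖ := by rw [← hw1]
    _ ≤ _ := ContinuousLinearMap.le_opNorm _ _

theorem IsMaximalDissipative.mem_resolventSet_adjoint [CompleteSpace X] {A : X →ₗ.[ℂ] X}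
    (hA : A.IsMaximalDissipative) {z : ℂ} (hz : 0 < z.im) : z ∈ A.adjoint.resolventSet := by
  rw [← star_star z]
  exact star_mem_resolventSet_adjoint hA.1.1 (hA.mem_resolventSet (by simpa using hz))

/-! ### Symmetric operators with surjective shifts -/

/-- A polarization argument: an operator with real quadratic form is symmetric. -/
theorem isFormalAdjoint_self_of_im_eq_zero {L : X →ₗ.[ℂ] X}
    (h : ∀ u : L.domain, (inner ℂ (u : X) (L u)).im = 0) : L.IsFormalAdjoint L := by
  have hq : ∀ u : L.domain, inner ℂ (L u) (u : X) = inner ℂ (u : X) (L u) := by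
    intro u
    rw [← inner_conj_symm]
    exact Complex.conj_eq_iff_im.mpr (h u)
  intro u v
  have h1 := hq (u + v)
  have h2 := hq (u + Complex.I • v)
  simp only [map_add, map_smul, Submodule.coe_add, Submodule.coe_smul, inner_add_left,
    inner_add_right, inner_smul_left, inner_smul_right, hq, Complex.conj_I] at h1 h2
  have hI := Complex.I_mul_I
  linear_combination (1 / 2) * h1 - (Complex.I / 2) * h2 +
    (1 / 2 * (inner ℂ (L u) (v : X) - inner ℂ (L v) (u : X) - inner ℂ (u : X) (L v)
      + inner ℂ (v : X) (L u))) * hI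

theorem mem_resolventSet_of_im_eq_zero {L : X →ₗ.[ℂ] X}
    (h : ∀ u : L.domain, (inner ℂ (u : X) (L u)).im = 0) {z : ℂ} (hz : z.im ≠ 0)
    (hs : Function.Surjective (L.shift z)) : z ∈ L.resolventSet := by
  refine mem_resolventSet_of_bound (abs_pos.mpr hz) (fun u => ?_) hs
  apply mul_norm_le_of_mul_sq_le
  rw [im_inner_shift, h, zero_sub, abs_neg, abs_mul, abs_of_nonneg (sq_nonneg ‖(u : X)‖)]

/-- A symmetric operator for which all `L - z` with non-real `z` are onto is selfadjoint; it is
automatically densely defined. -/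
theorem isSelfAdjoint_of_surjective_shift [CompleteSpace X] {L : X →ₗ.[ℂ] X}
    (h : ∀ u : L.domain, (inner ℂ (u : X) (L u)).im = 0)
    (hs : ∀ z : ℂ, z.im ≠ 0 → Function.Surjective (L.shift z)) : IsSelfAdjoint L := by
  have hfa := isFormalAdjoint_self_of_im_eq_zero h
  have hshift : ∀ (z : ℂ) (u v : L.domain),
      inner ℂ (L.shift z u) (v : X) = inner ℂ (u : X) (L.shift (star z) v) := by
    intro z u v
    rw [shift_apply, shift_apply, inner_sub_left, inner_sub_right, hfa u v, inner_smul_left,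
      inner_smul_right, Complex.star_def]
  have hd : Dense (L.domain : Set X) := by
    rw [Submodule.dense_iff_topologicalClosure_eq_top, Submodule.topologicalClosure_eq_top_iff,
      Submodule.eq_bot_iff]
    intro f hf
    obtain ⟨g, rfl⟩ := hs Complex.I (by simp) f
    have hg : (g : X) = 0 := by
      refine ext_inner_right ℂ fun w => ?_
      obtain ⟨u, rfl⟩ := hs (star Complex.I) (by simp) w
      rw [← hshift, inner_zero_left]
      exact Submodule.inner_left_of_mem_orthogonal u.2 hf
    obtain rfl : g = 0 := Subtype.ext hg
    exact (L.shift Complex.I).map_zero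
  rw [isSelfAdjoint_def]
  refine le_antisymm ?_ (hfa.le_adjoint hd)
  refine le_of_le_graph (f := L.adjoint) (g := L) ?_
  rintro ⟨y, w⟩ hy
  obtain ⟨y, h1, h2⟩ := (mem_graph_iff _).mp hy
  obtain rfl : (y : X) = _ := h1
  obtain rfl : L.adjoint y = _ := h2
  obtain ⟨x, hx⟩ := hs Complex.I (by simp) (L.adjoint.shift Complex.I y)
  have hxy : (x : X) = y := by
    refine ext_inner_right ℂ fun w => ?_
    obtain ⟨u, rfl⟩ := hs (star Complex.I) (by simp) w
    rw [← hshift, hx, shift_apply, shift_apply, inner_sub_left, inner_sub_right,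
      adjoint_isFormalAdjoint hd y u, inner_smul_left, inner_smul_right, Complex.star_def]
  rw [shift_apply, shift_apply, hxy] at hx
  rw [mem_graph_iff]
  exact ⟨x, hxy, sub_left_injective hx⟩

/-- A closed reducing subspace is invariant under the resolvents. -/
theorem IsReducing.resolventMap_mem {L : X →ₗ.[ℂ] X} {M : Submodule ℂ X}
    [M.HasOrthogonalProjection] (hM : L.IsReducing M) {z : ℂ} (hz : z ∈ L.resolventSet) {f : X}
    (hf : f ∈ M) : (L.resolventMap z f : X) ∈ M := by
  set u := L.resolventMap z f with hu
  obtain ⟨hP, hPM⟩ := hM.1 u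
  obtain ⟨hQ, hQM⟩ := hM.2 u
  have hsum : u = ⟨M.starProjection (u : X), hP⟩ + ⟨Mᗮ.starProjection (u : X), hQ⟩ := by
    refine Subtype.ext ?_
    change (u : X) = M.starProjection (u : X) + Mᗮ.starProjection (u : X)
    simp [Submodule.starProjection_orthogonal]
  have h1 : L.shift z ⟨M.starProjection (u : X), hP⟩ ∈ M :=
    M.sub_mem hPM (M.smul_mem z (M.starProjection_apply_mem _))
  have h2 : L.shift z ⟨Mᗮ.starProjection (u : X), hQ⟩ ∈ Mᗮ :=
    Mᗮ.sub_mem hQM (Mᗮ.smul_mem z (Mᗮ.starProjection_apply_mem _))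
  have h3 : L.shift z ⟨M.starProjection (u : X), hP⟩ + L.shift z ⟨Mᗮ.starProjection (u : X), hQ⟩
      = f := by
    rw [← _root_.map_add, ← hsum, hu, shift_resolventMap hz]
  have h4 : L.shift z ⟨Mᗮ.starProjection (u : X), hQ⟩ ∈ M := by
    rw [← eq_sub_iff_add_eq'] at h3
    rw [h3]
    exact M.sub_mem hf h1
  have h5 := Submodule.disjoint_def.mp M.orthogonal_disjoint _ h4 h2
  have h6 : (⟨Mᗮ.starProjection (u : X), hQ⟩ : L.domain) = 0 :=
    hz.1.1 (h5.trans (_root_.map_zero _).symm)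
  rw [h6, add_zero] at hsum
  rw [hsum]
  exact M.starProjection_apply_mem _

/-! ### The characteristic function and the coupling relation -/

section Coupling

variable {X Y Z : Type*} [NormedAddCommGroup X] [InnerProductSpace ℂ X]
  [NormedAddCommGroup Y] [InnerProductSpace ℂ Y] [NormedAddCommGroup Z] [InnerProductSpace ℂ Z]

theorem IsLagrangeOperator.two_mul_im_inner {B : X →ₗ.[ℂ] X} {r : ℝ} {Γ : B.domain →ₗ[ℂ] Y}
    (hΓ : B.IsLagrangeOperator (r * Complex.I) Γ) (u : B.domain) :
    2 * (inner ℂ (u : X) (B u)).im = r * ‖Γ u‖ ^ 2 := by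
  have h := congrArg Complex.im (hΓ.lagrange u u)
  rw [← inner_conj_symm (B u) (u : X), inner_self_eq_ofReal, Complex.im_mul_ofReal,
    Complex.sub_im, Complex.conj_im, Complex.im_ofReal_mul, Complex.I_im] at h
  linarith

/-- The characteristic function is a contraction on the range of `Γ`: with
`y = (A* - z)⁻¹ (A - z) u` one has `‖Γ u‖² - ‖Γs y‖² = 2 Im z ‖u - y‖²`. -/
theorem norm_gamma_resolventMap_adjoint_le [CompleteSpace X] {A : X →ₗ.[ℂ] X}
    (hA : Dense (A.domain : Set X)) {Γ : A.domain →ₗ[ℂ] Y}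
    (hΓ : A.IsLagrangeOperator Complex.I Γ) {Γs : A.adjoint.domain →ₗ[ℂ] Z}
    (hΓs : A.adjoint.IsLagrangeOperator (-Complex.I) Γs) {z : ℂ} (hz : 0 ≤ z.im)
    (hzA : z ∈ A.adjoint.resolventSet) (u : A.domain) :
    ‖Γs (A.adjoint.resolventMap z (A.shift z u))‖ ≤ ‖Γ u‖ := by
  set y := A.adjoint.resolventMap z (A.shift z u)
  have hy : A.adjoint.shift z y = A.shift z u := shift_resolventMap hzA _
  have h1 := IsLagrangeOperator.two_mul_im_inner (r := 1) (by simpa using hΓ) u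
  have h2 := IsLagrangeOperator.two_mul_im_inner (r := -1) (by simpa using hΓs) y
  have h3 := im_inner_shift A z u
  have h4 := im_inner_shift A.adjoint z y
  have h5 : inner ℂ (A.adjoint y) (u : X) = inner ℂ (y : X) (A u) := adjoint_isFormalAdjoint hA y u
  have e1 : A u = A.shift z u + z • (u : X) := by rw [shift_apply]; abel
  have e2 : A.adjoint y = A.shift z u + z • (y : X) := by rw [← hy, shift_apply]; abel
  rw [e1, e2, inner_add_left, inner_add_right, inner_smul_left, inner_smul_right,
    ← inner_conj_symm (A.shift z u) (u : X)] at h5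
  replace h5 := congrArg Complex.im h5
  simp only [Complex.add_im, Complex.mul_im, Complex.conj_im, Complex.conj_re] at h5
  rw [hy] at h4
  have h6 : ‖(y : X) - u‖ ^ 2 = ‖(y : X)‖ ^ 2 - 2 * (inner ℂ (y : X) (u : X)).re + ‖(u : X)‖ ^ 2 :=
    norm_sub_sq (𝕜 := ℂ) _ _
  refine le_of_sq_le_sq ?_ (norm_nonneg _)
  have h7 : 0 ≤ z.im * ‖(y : X) - u‖ ^ 2 := by positivity
  rw [h6] at h7
  nlinarith

/-- The linear relation `{((u, f), (eZ, eY))}` generated by the vectors with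
`u = x + c y`, `f = B x + c C y`, `eZ = ΓC y` and `eY = c ΓB x`, for `x ∈ D(B)` and `y ∈ D(C)`. -/
def coupling (B C : X →ₗ.[ℂ] X) (ΓB : B.domain →ₗ[ℂ] Y) (ΓC : C.domain →ₗ[ℂ] Z) (c : ℂ) :
    Set ((X × X) × Z × Y) :=
  range fun p : B.domain × C.domain =>
    (((p.1 : X) + c • (p.2 : X), B p.1 + c • C p.2), ΓC p.2, c • ΓB p.1)

variable [CompleteSpace X] [CompleteSpace Z]
  {B C : X →ₗ.[ℂ] X} {ΓB : B.domain →ₗ[ℂ] Y} {ΓC : C.domain →ₗ[ℂ] Z} {c z z' : ℂ}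

/-- The operator `(ΓC (C - z̄)⁻¹)*` on the range of `ΓC`, from the Lagrange identity of `C`. -/
theorem gammaField_apply_gamma (hBC : B.IsFormalAdjoint C) (hcc : c * c = -1)
    (hC : C.IsLagrangeOperator (-c) ΓC) (hz : z ∈ B.resolventSet) (hz' : z' ∈ C.resolventSet)
    (hzz : z' = star z) (y : C.domain) :
    C.gammaField ΓC z' (ΓC y) = -(c • ((y : X) - B.resolventMap z (C.shift z y))) := by
  subst hzz
  refine ext_inner_left ℂ fun h => ?_
  rw [hC.inner_gammaField hz', inner_neg_right, inner_smul_right, inner_sub_right]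
  set w := C.resolventMap (star z) h with hw
  set x := B.resolventMap z (C.shift z y) with hx
  have h1 := hC.lagrange y w
  have h2 : inner ℂ (B x) (w : X) = inner ℂ (x : X) (C w) := hBC x w
  rw [hx, apply_resolventMap hz, ← hx, hw, apply_resolventMap hz', ← hw, shift_apply] at h2
  rw [hw, apply_resolventMap hz', ← hw] at h1
  have h3 := congrArg (starRingEnd ℂ) h2
  simp only [inner_add_left, inner_sub_left, inner_smul_left, inner_add_right, inner_smul_right,
    _root_.map_add, _root_.map_sub, _root_.map_mul, inner_conj_symm, Complex.conj_conj,
    Complex.star_def] at h1 h3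
  linear_combination -c * h1 + c * h3 + inner ℂ (ΓC w) (ΓC y) * hcc

/-- The closure of `coupling` is the graph of a bounded operator
`(f - z u, eZ) ↦ (u, eY)`, for each admissible `z`; in particular that graph, in whose description
`z` occurs, does not depend on `z`. -/
theorem mem_closure_coupling_iff (hBC : B.IsFormalAdjoint C) (hcc : c * c = -1)
    (hB : B.IsLagrangeOperator c ΓB) (hC : C.IsLagrangeOperator (-c) ΓC)
    (hz : z ∈ B.resolventSet) (hz' : z' ∈ C.resolventSet) (hzz : z' = star z)
    (S : Z →L[ℂ] Y) (hS : ∀ y, S (ΓC y) = ΓB (B.resolventMap z (C.shift z y)))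
    (u f : X) (eZ : Z) (eY : Y) :
    ((u, f), eZ, eY) ∈ _root_.closure (coupling B C ΓB ΓC c) ↔
      ∃ hm : u + C.gammaField ΓC z' eZ ∈ B.domain,
        f = B ⟨_, hm⟩ - z • C.gammaField ΓC z' eZ ∧ eY = S eZ + c • ΓB ⟨_, hm⟩ := by
  have hG := gammaField_apply_gamma (ΓC := ΓC) hBC hcc hC hz hz' hzz
  set G := C.gammaField ΓC z'
  have hcR := continuous_resolventMap hz
  have hcΓ : Continuous fun h => ΓB (B.resolventMap z h) := hB.continuous_comp_resolventMap hz
  have hpar : (∃ hm : u + G eZ ∈ B.domain,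
        f = B ⟨_, hm⟩ - z • G eZ ∧ eY = S eZ + c • ΓB ⟨_, hm⟩) ↔
      u + G eZ = B.resolventMap z (f - z • u) ∧
        eY = S eZ + c • ΓB (B.resolventMap z (f - z • u)) := by
    constructor
    · rintro ⟨hm, h1, h2⟩
      have : B.resolventMap z (f - z • u) = ⟨_, hm⟩ := by
        refine resolventMap_eq_of_shift_eq hz ?_
        rw [shift_apply, h1, smul_add]
        abel
      rw [this]
      exact ⟨rfl, h2⟩
    · rintro ⟨h1, h2⟩
      have hm : u + G eZ ∈ B.domain := h1 ▸ (B.resolventMap z (f - z • u)).2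
      have : (⟨_, hm⟩ : B.domain) = B.resolventMap z (f - z • u) := Subtype.ext h1
      refine ⟨hm, ?_, this ▸ h2⟩
      rw [this, apply_resolventMap hz, ← h1, smul_add]
      abel
  rw [hpar]
  constructor
  · intro hp
    have hcl : _root_.IsClosed {p : (X × X) × Z × Y |
        p.1.1 + G p.2.1 = B.resolventMap z (p.1.2 - z • p.1.1) ∧
          p.2.2 = S p.2.1 + c • ΓB (B.resolventMap z (p.1.2 - z • p.1.1))} := by
      have hd : Continuous fun p : (X × X) × Z × Y => p.1.2 - z • p.1.1 := by fun_prop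
      exact (isClosed_eq (by fun_prop) (hcR.comp hd)).inter
        (isClosed_eq (by fun_prop) (((S.continuous.comp (by fun_prop)).add
          ((hcΓ.comp hd).const_smul c))))
    refine closure_minimal ?_ hcl hp
    rintro _ ⟨⟨x, y⟩, rfl⟩
    have hw : B.resolventMap z (B x + c • C y - z • ((x : X) + c • (y : X)))
        = x + c • B.resolventMap z (C.shift z y) := by
      refine resolventMap_eq_of_shift_eq hz ?_
      rw [_root_.map_add, _root_.map_smul, shift_resolventMap hz, shift_apply, shift_apply,
        smul_sub, smul_add,
        smul_comm c z]
      abel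
    simp only [mem_ofPred_eq, hw]
    simp only [hG, hS, _root_.map_add, _root_.map_smul, smul_add, smul_smul, hcc, Submodule.coe_add,
      Submodule.coe_smul, smul_sub, neg_smul, one_smul]
    constructor <;> abel
  · rintro ⟨h1, h2⟩
    let Φ : Z → (X × X) × Z × Y := fun e =>
      (((B.resolventMap z (f - z • u) : X) - G e,
        f - z • u + z • ((B.resolventMap z (f - z • u) : X) - G e)), e,
        S e + c • ΓB (B.resolventMap z (f - z • u)))
    have hΦ : Continuous Φ := by fun_prop
    have hp : Φ eZ = ((u, f), eZ, eY) := by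
      simp only [Φ, ← h1, ← h2, add_sub_cancel_right, sub_add_cancel]
    rw [← hp]
    refine hC.denseRange.induction_on (p := fun e => Φ e ∈ _root_.closure (coupling B C ΓB ΓC c)) eZ
      (isClosed_closure.preimage hΦ) fun y => subset_closure ?_
    have h3 := apply_resolventMap hz (f - z • u)
    have h4 := apply_resolventMap hz (C.shift z y)
    refine ⟨(B.resolventMap z (f - z • u) - c • B.resolventMap z (C.shift z y), y), ?_⟩
    simp only [Φ, hG, hS]
    generalize B.resolventMap z (f - z • u) = r at *
    generalize B.resolventMap z (C.shift z y) = x at *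
    simp only [_root_.map_sub, _root_.map_smul, LinearPMap.map_sub, LinearPMap.map_smul, h3, h4,
      Submodule.coe_sub,
      Submodule.coe_smul, smul_sub, smul_add, shift_apply, smul_smul, hcc, neg_smul, one_smul,
      sub_neg_eq_add, mul_comm c z]
    refine Prod.ext (Prod.ext ?_ ?_) (Prod.ext rfl ?_) <;> simp only <;> abel

end Coupling

end LinearPMap

namespace Dilation

open LinearPMap (coupling shift_apply apply_resolventMap im_inner_shift inner_self_eq_ofReal
  norm_gamma_resolventMap_adjoint_le mem_closure_coupling_iff adjoint_isFormalAdjoint)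

variable {H E Es : Type*}
  [NormedAddCommGroup H] [InnerProductSpace ℂ H] [CompleteSpace H]
  [NormedAddCommGroup E] [InnerProductSpace ℂ E]
  [NormedAddCommGroup Es] [InnerProductSpace ℂ Es]
  {A : H →ₗ.[ℂ] H} {Γ : A.domain →ₗ[ℂ] E} {Γs : A.adjoint.domain →ₗ[ℂ] Es}

theorem straus_apply_gamma [CompleteSpace Es] (hA : A.IsMaximalDissipative)
    (hΓ : A.IsLagrangeOperator Complex.I Γ)
    (hΓs : A.adjoint.IsLagrangeOperator (-Complex.I) Γs) {z : ℂ} (hz : 0 < z.im) (u : A.domain) :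
    straus A Γ Γs z (Γ u) = Γs (A.adjoint.resolventMap z (A.shift z u)) := by
  have hex : ∃ S : E →L[ℂ] Es, ∀ u : A.domain,
      S (Γ u) = Γs (A.adjoint.resolventMap z (A.shift z u)) := by
    let T : A.domain →ₗ[ℂ] Es := Γs ∘ₗ A.adjoint.resolventMap z ∘ₗ A.shift z
    have hT : ∀ u, ‖T u‖ ≤ 1 * ‖Γ u‖ := fun u => by
      rw [one_mul]
      exact norm_gamma_resolventMap_adjoint_le hA.1.1 hΓ hΓs hz.le
        (hA.mem_resolventSet_adjoint hz) u
    exact ⟨T.extendOfNorm Γ, fun u => LinearMap.extendOfNorm_eq hΓ.denseRange ⟨1, hT⟩ u⟩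
  rw [straus, dif_pos hex]
  exact hex.choose_spec u

/-- The adjoint of the characteristic function is the one with `A` and `A*` exchanged. -/
theorem adjoint_straus_apply_gamma [CompleteSpace E] [CompleteSpace Es]
    (hA : A.IsMaximalDissipative)
    (hΓ : A.IsLagrangeOperator Complex.I Γ)
    (hΓs : A.adjoint.IsLagrangeOperator (-Complex.I) Γs) {z z' : ℂ} (hz : z.im < 0)
    (hzz : z' = star z) (y : A.adjoint.domain) :
    ContinuousLinearMap.adjoint (straus A Γ Γs z') (Γs y)
      = Γ (A.resolventMap z (A.adjoint.shift z y)) := by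
  subst hzz
  have hz' : 0 < (star z).im := by simpa using hz
  have hzA := hA.mem_resolventSet hz
  have hzA' := hA.mem_resolventSet_adjoint hz'
  refine hΓ.denseRange.eq_of_inner_left ℂ fun u => ?_
  rw [ContinuousLinearMap.adjoint_inner_left, straus_apply_gamma hA hΓ hΓs hz']
  set y' := A.adjoint.resolventMap (star z) (A.shift (star z) u) with hy'
  set x := A.resolventMap z (A.adjoint.shift z y) with hx
  have h1 := hΓs.lagrange y' y
  have h2 := hΓ.lagrange u x
  have hfa := adjoint_isFormalAdjoint hA.1.1
  have h3 : inner ℂ (A.adjoint y') (x : H) = inner ℂ (y' : H) (A x) := hfa y' x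
  have h4 : inner ℂ (A.adjoint y) (u : H) = inner ℂ (y : H) (A u) := hfa y u
  rw [hy', apply_resolventMap hzA', ← hy', shift_apply] at h1 h3
  rw [hx, apply_resolventMap hzA, ← hx, shift_apply] at h2 h3
  have h5 := congrArg (starRingEnd ℂ) h3
  simp only [inner_add_left, inner_sub_left, inner_smul_left, inner_add_right, inner_sub_right,
    inner_smul_right, map_add, map_sub, map_mul, inner_conj_symm, Complex.conj_conj,
    Complex.star_def] at h1 h2 h5
  linear_combination -Complex.I * h1 - Complex.I * h2 - Complex.I * h4 + Complex.I * h5 +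
    (inner ℂ (Γs y) (Γs y') - inner ℂ (Γ x) (Γ u)) * Complex.I_mul_I

/-! ### The boundary relation -/

variable (A Γ Γs) in
/-- The closed linear relation of all `((u, f), (e₋, e₊))` for which `(v₋, u, v₊)` with boundary
values `e₋`, `e₊` is in the domain of the dilation, and `f` is the component in `H` of its image.
It is defined without reference to the parameters `λ` and `μ`. -/
def boundaryRelation : Set ((H × H) × Es × E) :=
  closure (coupling A A.adjoint Γ Γs Complex.I)

/-- The description of the domain by condition (I) and of the image by `T_*`. -/
theorem mem_boundaryRelation_iff_minus [CompleteSpace E] [CompleteSpace Es]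
    (hA : A.IsMaximalDissipative)
    (hΓ : A.IsLagrangeOperator Complex.I Γ)
    (hΓs : A.adjoint.IsLagrangeOperator (-Complex.I) Γs) {mu : ℂ} (hmu : mu.im < 0)
    (u f : H) (em : Es) (ep : E) :
    ((u, f), em, ep) ∈ boundaryRelation A Γ Γs ↔
      ∃ hm : u + A.adjoint.gammaField Γs (-mu) em ∈ A.domain,
        f = A ⟨_, hm⟩ + star mu • A.adjoint.gammaField Γs (-mu) em ∧
        ep = ContinuousLinearMap.adjoint (straus A Γ Γs (-mu)) em + Complex.I • Γ ⟨_, hm⟩ := by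
  have hz : (-star mu).im < 0 := by simpa using hmu
  have hzz : -mu = star (-star mu) := by simp
  have := mem_closure_coupling_iff (adjoint_isFormalAdjoint hA.1.1).symm Complex.I_mul_I
    hΓ hΓs (hA.mem_resolventSet hz) (hA.mem_resolventSet_adjoint (z := -mu) (by simpa))
    hzz (ContinuousLinearMap.adjoint (straus A Γ Γs (-mu)))
    (adjoint_straus_apply_gamma hA hΓ hΓs hz hzz) u f em ep
  simp only [neg_smul, sub_neg_eq_add] at this
  exact this

/-- The description of the domain by condition (II) and of the image by `T`. -/
theorem mem_boundaryRelation_iff_plus [CompleteSpace E] [CompleteSpace Es]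
    (hA : A.IsMaximalDissipative)
    (hΓ : A.IsLagrangeOperator Complex.I Γ)
    (hΓs : A.adjoint.IsLagrangeOperator (-Complex.I) Γs) {lam : ℂ} (hlam : 0 < lam.im)
    (u f : H) (em : Es) (ep : E) :
    ((u, f), em, ep) ∈ boundaryRelation A Γ Γs ↔
      ∃ hm : u + A.gammaField Γ (-lam) ep ∈ A.adjoint.domain,
        f = A.adjoint ⟨_, hm⟩ + star lam • A.gammaField Γ (-lam) ep ∧
        em = straus A Γ Γs (-star lam) ep - Complex.I • Γs ⟨_, hm⟩ := by
  have hz : 0 < (-star lam).im := by simpa using hlam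
  have hzz : -lam = star (-star lam) := by simp
  have := mem_closure_coupling_iff (adjoint_isFormalAdjoint hA.1.1) (c := -Complex.I) (by simp)
    hΓs (by simpa using hΓ) (hA.mem_resolventSet_adjoint hz)
    (hA.mem_resolventSet (z := -lam) (by simpa)) hzz (straus A Γ Γs (-star lam))
    (straus_apply_gamma hA hΓ hΓs hz) u f ep em
  simp only [neg_smul, sub_neg_eq_add, ← sub_eq_add_neg] at this
  rw [← this]
  -- Exchanging the roles of `A` and `A*` gives the same relation: substitute `(-i y, i x)` for
  -- `(x, y)` and swap the boundary values.
  let σ : (H × H) × Es × E ≃ₜ (H × H) × E × Es :=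
    (Homeomorph.refl (H × H)).prodCongr (Homeomorph.prodComm Es E)
  have hσ : σ ⁻¹' coupling A.adjoint A Γs Γ (-Complex.I) = coupling A A.adjoint Γ Γs Complex.I := by
    ext ⟨⟨u, f⟩, em, ep⟩
    have hI : Complex.I * -Complex.I = 1 := by simp
    have hI' : -Complex.I * Complex.I = 1 := by simp
    constructor
    · rintro ⟨⟨x, y⟩, h⟩
      replace h : ((_, _), _, _) = ((u, f), ep, em) := h
      simp only [Prod.mk.injEq] at h
      obtain ⟨⟨rfl, rfl⟩, rfl, rfl⟩ := h
      refine ⟨(-Complex.I • y, -Complex.I • x), ?_⟩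
      simp [smul_smul, LinearPMap.map_neg, LinearPMap.map_smul, add_comm]
    · rintro ⟨⟨x, y⟩, h⟩
      simp only [Prod.mk.injEq] at h
      obtain ⟨⟨rfl, rfl⟩, rfl, rfl⟩ := h
      refine ⟨(Complex.I • y, Complex.I • x), ?_⟩
      simp [σ, smul_smul, LinearPMap.map_smul, add_comm]
  rw [boundaryRelation, ← hσ, ← σ.preimage_closure]
  rfl

theorem two_mul_im_inner_of_mem_boundaryRelation (hA : A.IsMaximalDissipative)
    (hΓ : A.IsLagrangeOperator Complex.I Γ)
    (hΓs : A.adjoint.IsLagrangeOperator (-Complex.I) Γs) {u f : H} {em : Es} {ep : E}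
    (h : ((u, f), em, ep) ∈ boundaryRelation A Γ Γs) :
    2 * (inner ℂ u f).im = ‖ep‖ ^ 2 - ‖em‖ ^ 2 := by
  have hcl : _root_.IsClosed {p : (H × H) × Es × E |
      2 * (inner ℂ p.1.1 p.1.2).im = ‖p.2.2‖ ^ 2 - ‖p.2.1‖ ^ 2} :=
    isClosed_eq (continuous_const.mul (Complex.continuous_im.comp (by fun_prop))) (by fun_prop)
  refine closure_minimal ?_ hcl h
  rintro _ ⟨⟨x, y⟩, rfl⟩
  have h1 := LinearPMap.IsLagrangeOperator.two_mul_im_inner (r := 1) (by simpa using hΓ) x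
  have h2 := LinearPMap.IsLagrangeOperator.two_mul_im_inner (r := -1) (by simpa using hΓs) y
  have h3 : inner ℂ (A.adjoint y) (x : H) = inner ℂ (y : H) (A x) :=
    adjoint_isFormalAdjoint hA.1.1 y x
  have h4 := congrArg Complex.re h3
  rw [← inner_conj_symm, Complex.conj_re] at h4
  simp only [mem_ofPred_eq, inner_add_left, inner_add_right, inner_smul_left, inner_smul_right,
    norm_smul, Complex.norm_I, one_mul, Complex.add_im, Complex.add_re, Complex.mul_im, Complex.mul_re,
    Complex.conj_I, Complex.neg_re, Complex.neg_im, Complex.I_re, Complex.I_im]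
  linarith

theorem boundaryRelation_of_domain (x : A.domain) :
    (((x : H), A x), (0 : Es), Complex.I • Γ x) ∈ boundaryRelation A Γ Γs :=
  subset_closure ⟨(x, 0), by simp⟩

theorem boundaryRelation_of_adjoint_domain (y : A.adjoint.domain) :
    (((y : H), A.adjoint y), -(Complex.I • Γs y), (0 : E)) ∈ boundaryRelation A Γ Γs :=
  subset_closure ⟨(0, -(Complex.I • y)), by simp [smul_smul, LinearPMap.map_neg, LinearPMap.map_smul]⟩

end Dilation

namespace Channel

open Filter Topology

/-! ### Green's formula on the half-line -/

section Green

/-- A function whose increments are controlled by those of an absolutely continuous function is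
absolutely continuous. -/
theorem absolutelyContinuousOnInterval_of_dist_le {X Y : Type*} [PseudoMetricSpace X]
    [PseudoMetricSpace Y] {f : ℝ → X} {n : ℝ → Y} {a b K : ℝ}
    (hn : AbsolutelyContinuousOnInterval n a b)
    (h : ∀ x ∈ uIcc a b, ∀ y ∈ uIcc a b, dist (f x) (f y) ≤ K * dist (n x) (n y)) :
    AbsolutelyContinuousOnInterval f a b := by
  unfold AbsolutelyContinuousOnInterval at hn ⊢
  refine squeeze_zero' ?_ ?_ (by simpa using hn.const_mul K)
  · exact Eventually.of_forall fun _ => Finset.sum_nonneg fun _ _ => dist_nonneg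
  · rw [eventually_inf_principal]
    filter_upwards with ⟨m, I⟩ hI
    simp only [AbsolutelyContinuousOnInterval.disjWithin, mem_ofPred_eq] at hI
    rw [Finset.mul_sum]
    exact Finset.sum_le_sum fun i hi => h _ (hI.1 i hi).1 _ (hI.1 i hi).2

theorem intervalIntegrable_of_nonneg {F : Type*} [NormedAddCommGroup F] (g : L2 (Ioi 0) F) {a b : ℝ}
    (ha : 0 ≤ a) (hb : 0 ≤ b) :
    IntervalIntegrable g volume a b := by
  have h := intervalIntegrable g a b
  rw [intervalIntegrable_iff] at h ⊢
  rwa [IntegrableOn, Measure.restrict_restrict measurableSet_uIoc, inter_eq_left.mpr] at h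
  exact fun x hx => (le_min ha hb).trans_lt hx.1

variable {F : Type*} [NormedAddCommGroup F] [InnerProductSpace ℂ F]

theorem integral_restrict_Ioi (g : ℝ → F) {x : ℝ} (hx : 0 < x) :
    ∫ t in (0 : ℝ)..x, g t ∂(volume.restrict (Ioi 0)) = ∫ t in (0 : ℝ)..x, g t := by
  rw [intervalIntegral.integral_of_le hx.le, intervalIntegral.integral_of_le hx.le,
    Measure.restrict_restrict measurableSet_Ioc, inter_eq_left.mpr Ioc_subset_Ioi_self]

theorem mem_sobolevGraph_Ioi_iff {p : L2 (Ioi 0) F × (F × L2 (Ioi 0) F)} :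
    p ∈ sobolevGraph (Ioi 0) F ↔
      ∀ᵐ x ∂(volume.restrict (Ioi 0)), p.1 x = p.2.1 + ∫ t in (0 : ℝ)..x, p.2.2 t := by
  change (∀ᵐ x ∂(volume.restrict (Ioi 0)),
    p.1 x = p.2.1 + ∫ t in (0 : ℝ)..x, p.2.2 t ∂(volume.restrict (Ioi 0))) ↔ _
  rw [ae_restrict_iff' measurableSet_Ioi, ae_restrict_iff' measurableSet_Ioi]
  refine eventually_congr (Eventually.of_forall fun x => forall_congr' fun hx => ?_)
  rw [integral_restrict_Ioi _ hx]

variable [CompleteSpace F]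

/-- Green's formula `2 Re ∫₀ᴺ ⟨w, w'⟩ = ‖w(N)‖² - ‖w(0)‖²` for an absolutely continuous `w`. -/
theorem integral_re_inner_primitive {g : ℝ → F} {N : ℝ}
    (hg : IntervalIntegrable g volume 0 N) (e : F) :
    ∫ x in (0 : ℝ)..N, 2 * (inner ℂ (e + ∫ t in (0 : ℝ)..x, g t) (g x)).re
      = ‖e + ∫ t in (0 : ℝ)..N, g t‖ ^ 2 - ‖e‖ ^ 2 := by
  set w : ℝ → F := fun x => e + ∫ t in (0 : ℝ)..x, g t with hw
  have hsub : ∀ x ∈ uIcc 0 N, ∀ y ∈ uIcc 0 N, IntervalIntegrable g volume x y :=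
    fun x hx y hy => hg.mono_set (uIcc_subset_uIcc hx hy)
  have h0 : (0 : ℝ) ∈ uIcc 0 N := left_mem_uIcc
  have hwd : ∀ x ∈ uIcc 0 N, ∀ y ∈ uIcc 0 N, ‖w x - w y‖
      ≤ dist (∫ t in (0 : ℝ)..x, ‖g t‖) (∫ t in (0 : ℝ)..y, ‖g t‖) := by
    intro x hx y hy
    rw [hw, add_sub_add_left_eq_sub, intervalIntegral.integral_interval_sub_left (hsub 0 h0 x hx)
      (hsub 0 h0 y hy), Real.dist_eq, intervalIntegral.integral_interval_sub_left
      (hsub 0 h0 x hx).norm (hsub 0 h0 y hy).norm]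
    exact intervalIntegral.norm_integral_le_abs_integral_norm
  have hn := hg.norm.absolutelyContinuousOnInterval_intervalIntegral (c := 0) h0
  have hwc : AbsolutelyContinuousOnInterval w 0 N :=
    absolutelyContinuousOnInterval_of_dist_le (K := 1) hn fun x hx y hy => by
      rw [one_mul, dist_eq_norm]
      exact hwd x hx y hy
  obtain ⟨M, hM⟩ := hwc.exists_bound
  have hφ : AbsolutelyContinuousOnInterval (fun x => ‖w x‖ ^ 2) 0 N := by
    refine absolutelyContinuousOnInterval_of_dist_le (K := 2 * M) hn fun x hx y hy => ?_
    have h1 := hM x hx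
    have h2 := hM y hy
    have h3 := norm_nonneg (w x)
    calc dist (‖w x‖ ^ 2) (‖w y‖ ^ 2) = (‖w x‖ + ‖w y‖) * |‖w x‖ - ‖w y‖| := by
          rw [Real.dist_eq, sq_sub_sq, abs_mul, abs_of_nonneg (by positivity)]
      _ ≤ (2 * M) * ‖w x - w y‖ := by
          gcongr
          · linarith
          · linarith
          · exact abs_norm_sub_norm_le _ _
      _ ≤ _ := by
          gcongr
          · linarith
          · exact hwd x hx y hy
  have hderiv := hφ.integral_deriv_eq_sub
  have hw0 : w 0 = e := by simp [hw]
  rw [hw0] at hderiv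
  rw [← hderiv]
  refine intervalIntegral.integral_congr_ae ?_
  filter_upwards [hg.ae_hasDerivAt_integral] with x hx hxm
  have h1 : HasDerivAt w (g x) x := (hx (uIoc_subset_uIcc hxm) 0 h0).const_add e
  have h2 := (Complex.reCLM.hasFDerivAt.comp_hasDerivAt x (h1.inner ℂ h1))
  have h3 : (fun x => ‖w x‖ ^ 2) = Complex.reCLM ∘ fun t => inner ℂ (w t) (w t) := by
    funext t
    simp [inner_self_eq_norm_sq_to_K, ← Complex.ofReal_pow]
  have h4 : (inner ℂ (g x) (w x)).re = (inner ℂ (w x) (g x)).re := by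
    rw [← inner_conj_symm, Complex.conj_re]
  rw [h3, h2.deriv]
  change 2 * (inner ℂ (w x) (g x)).re = (inner ℂ (w x) (g x) + inner ℂ (g x) (w x)).re
  rw [Complex.add_re, h4]
  ring

/-- Green's formula on `(0, ∞)`: `2 Re ⟨v, v'⟩ = -‖v(0)‖²` for `v` of class `H¹`. The boundary term at
infinity vanishes since `‖v‖²` has a limit there and is integrable. -/
theorem two_mul_re_inner_of_mem_sobolevGraph_Ioi {p : L2 (Ioi 0) F × (F × L2 (Ioi 0) F)}
    (hp : p ∈ sobolevGraph (Ioi 0) F) : 2 * (inner ℂ p.1 p.2.2).re = -‖p.2.1‖ ^ 2 := by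
  obtain ⟨v, e, g⟩ := p
  replace hp := mem_sobolevGraph_Ioi_iff.mp hp
  simp only at hp ⊢
  set w : ℝ → F := fun x => e + ∫ t in (0 : ℝ)..x, g t with hw
  have hint : IntegrableOn (fun x => 2 * (inner ℂ (v x) (g x)).re) (Ioi 0) :=
    (L2.integrable_inner (𝕜 := ℂ) v g).re.const_mul 2
  have hlim := intervalIntegral_tendsto_integral_Ioi 0 hint tendsto_id
  have hval : ∫ x in Ioi 0, 2 * (inner ℂ (v x) (g x)).re = 2 * (inner ℂ v g).re := by
    rw [integral_const_mul, L2.inner_def]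
    congr 1
    exact integral_re (L2.integrable_inner (𝕜 := ℂ) v g)
  have hN : ∀ N : ℝ, 0 < N →
      ∫ x in (0 : ℝ)..N, 2 * (inner ℂ (v x) (g x)).re = ‖w N‖ ^ 2 - ‖e‖ ^ 2 := by
    intro N hN
    rw [← integral_re_inner_primitive (intervalIntegrable_of_nonneg g le_rfl hN.le)]
    refine intervalIntegral.integral_congr_ae ?_
    rw [ae_restrict_iff' measurableSet_Ioi] at hp
    filter_upwards [hp] with x hx hxm
    rw [uIoc_of_le hN.le] at hxm
    rw [hx hxm.1]
  have hlim2 : Tendsto (fun N => ‖w N‖ ^ 2) atTop (𝓝 (2 * (inner ℂ v g).re + ‖e‖ ^ 2)) := by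
    rw [← hval]
    refine (hlim.add_const (‖e‖ ^ 2)).congr' ?_
    filter_upwards [eventually_gt_atTop 0] with N h
    rw [id, hN N h, sub_add_cancel]
  have hwint : IntegrableOn (fun x => ‖w x‖ ^ 2) (Ioi 0) := by
    have h1 := (memLp_two_iff_integrable_sq_norm (Lp.aestronglyMeasurable v)).mp (Lp.memLp v)
    refine h1.congr ?_
    filter_upwards [hp] with x hx
    rw [hx]
  have h0 := IntegrableAtFilter.eq_zero_of_tendsto (l := atTop) (μ := volume)
    ⟨Ioi 0, Ioi_mem_atTop 0, hwint⟩ (fun s hs => ?_) hlim2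
  · linarith
  · obtain ⟨b, hb⟩ := mem_atTop_sets.mp hs
    exact measure_mono_top (fun x hx => hb x hx) (Real.volume_Ici (a := b))

/-! ### The graph of the derivative is closed -/

theorem isClosed_sobolevGraph_Ioi :
    IsClosed (sobolevGraph (Ioi 0) F : Set (L2 (Ioi 0) F × (F × L2 (Ioi 0) F))) := by
  refine IsSeqClosed.isClosed fun p q hp hq => ?_
  refine mem_sobolevGraph_Ioi_iff.mpr ?_
  have h1 : Tendsto (fun n => (p n).1) atTop (𝓝 q.1) := (continuous_fst.tendsto q).comp hq
  have h2 : Tendsto (fun n => (p n).2.1) atTop (𝓝 q.2.1) :=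
    ((continuous_fst.comp continuous_snd).tendsto q).comp hq
  have h3 : Tendsto (fun n => (p n).2.2) atTop (𝓝 q.2.2) :=
    ((continuous_snd.comp continuous_snd).tendsto q).comp hq
  obtain ⟨ns, hns, hae⟩ := (tendstoInMeasure_of_tendsto_Lp h1).exists_seq_tendsto_ae
  have hpn : ∀ᵐ x ∂(volume.restrict (Ioi 0)), ∀ n,
      (p n).1 x = (p n).2.1 + ∫ t in (0 : ℝ)..x, (p n).2.2 t :=
    ae_all_iff.mpr fun n => mem_sobolevGraph_Ioi_iff.mp (hp n)
  filter_upwards [hae, hpn, ae_restrict_mem measurableSet_Ioi] with x hx hxn hx0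
  -- The integrals over `(0, x)` converge weakly, being inner products with indicator functions.
  refine ext_inner_left ℂ fun a => ?_
  have hfin : (volume.restrict (Ioi (0 : ℝ))) (Ioc 0 x) ≠ ⊤ :=
    ((Measure.restrict_apply_le _ _).trans_lt (by simp)).ne
  have hint : ∀ g : L2 (Ioi 0) F, inner ℂ a (∫ t in (0 : ℝ)..x, g t)
      = inner ℂ (indicatorConstLp 2 measurableSet_Ioc hfin a) g := by
    intro g
    rw [L2.inner_indicatorConstLp_eq_inner_setIntegral,
      Measure.restrict_restrict measurableSet_Ioc, inter_eq_left.mpr Ioc_subset_Ioi_self,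
      intervalIntegral.integral_of_le (le_of_lt hx0)]
  have hl : Tendsto (fun n => inner ℂ a ((p (ns n)).1 x)) atTop (𝓝 (inner ℂ a (q.1 x))) :=
    tendsto_const_nhds.inner hx
  have hr : Tendsto (fun n => inner ℂ a ((p (ns n)).1 x)) atTop
      (𝓝 (inner ℂ a (q.2.1 + ∫ t in (0 : ℝ)..x, q.2.2 t))) := by
    simp only [hxn, inner_add_right, hint]
    exact (tendsto_const_nhds.inner (h2.comp hns.tendsto_atTop)).add
      (tendsto_const_nhds.inner (h3.comp hns.tendsto_atTop))
  exact tendsto_nhds_unique hl hr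

end Green

/-! ### Exponentials on the half-line -/

section Exponential

variable {F : Type*} [NormedAddCommGroup F] [InnerProductSpace ℂ F]

theorem norm_cexp_neg_mul (κ : ℂ) (x : ℝ) : ‖Complex.exp (-κ * x)‖ = Real.exp (-κ.re * x) := by
  rw [Complex.norm_exp]
  simp

theorem memLp_cexp_smul {κ : ℂ} (hκ : 0 < κ.re) (e : F) :
    MemLp (fun x : ℝ => Complex.exp (-κ * x) • e) 2 (volume.restrict (Ioi 0)) := by
  have hc : Continuous fun x : ℝ => Complex.exp (-κ * x) • e := by fun_prop
  rw [memLp_two_iff_integrable_sq_norm hc.aestronglyMeasurable]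
  have h := (exp_neg_integrableOn_Ioi 0 (b := 2 * κ.re) (by positivity)).mul_const (‖e‖ ^ 2)
  refine h.congr (Eventually.of_forall fun x => ?_)
  beta_reduce
  rw [norm_smul, norm_cexp_neg_mul, mul_pow, ← Real.exp_nat_mul]
  congr 2
  push_cast
  ring

/-- The function `x ↦ exp(-κ x) e` on `(0, ∞)`, for `Re κ > 0`. -/
noncomputable def expo (κ : ℂ) (hκ : 0 < κ.re) : F →ₗ[ℂ] L2 (Ioi 0) F where
  toFun e := (memLp_cexp_smul hκ e).toLp _
  map_add' e f := by
    rw [← MemLp.toLp_add]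
    congr 1
    funext x
    simp
  map_smul' c e := by
    rw [RingHom.id_apply, ← MemLp.toLp_const_smul]
    congr 1
    funext x
    simp [smul_comm c]

theorem coeFn_expo {κ : ℂ} (hκ : 0 < κ.re) (e : F) :
    expo κ hκ e =ᵐ[volume.restrict (Ioi 0)] fun x : ℝ => Complex.exp (-κ * x) • e :=
  (memLp_cexp_smul hκ e).coeFn_toLp

theorem inner_expo {κ : ℂ} (hκ : 0 < κ.re) (e : F) (g : L2 (Ioi 0) F) :
    inner ℂ (expo κ hκ e) g = ∫ x in Ioi (0 : ℝ), Complex.exp (-star κ * x) * inner ℂ e (g x) := by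
  rw [L2.inner_def]
  refine integral_congr_ae ?_
  filter_upwards [coeFn_expo hκ e] with x hx
  rw [hx, inner_smul_left, ← Complex.exp_conj]
  simp

variable [CompleteSpace F]

theorem expo_mem_sobolevGraph {κ : ℂ} (hκ : 0 < κ.re) (e : F) :
    (expo κ hκ e, (e, -κ • expo κ hκ e)) ∈ sobolevGraph (Ioi 0) F := by
  rw [mem_sobolevGraph_Ioi_iff]
  have h1 := coeFn_expo hκ e
  have h2 : (-κ • expo κ hκ e : L2 (Ioi 0) F) =ᵐ[volume.restrict (Ioi 0)]
      fun x : ℝ => -κ • Complex.exp (-κ * x) • e := by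
    filter_upwards [Lp.coeFn_smul (-κ) (expo κ hκ e), h1] with x hx1 hx2
    rw [hx1, Pi.smul_apply, hx2]
  rw [Filter.EventuallyEq, ae_restrict_iff' measurableSet_Ioi] at h2
  filter_upwards [h1, ae_restrict_mem measurableSet_Ioi] with x hx hx0
  have h3 : ∫ t in (0 : ℝ)..x, (-κ • expo κ hκ e : L2 (Ioi 0) F) t
      = ∫ t in (0 : ℝ)..x, -κ • Complex.exp (-κ * t) • e := by
    refine intervalIntegral.integral_congr_ae ?_
    filter_upwards [h2] with t ht htm
    rw [uIoc_of_le (le_of_lt hx0)] at htm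
    exact ht htm.1
  have hd : ∀ t : ℝ, HasDerivAt (fun t : ℝ => Complex.exp (-κ * t) • e)
      (-κ • Complex.exp (-κ * t) • e) t := by
    intro t
    have := ((((hasDerivAt_id t).ofReal_comp).const_mul (-κ)).cexp).smul_const e
    simpa [smul_smul, mul_comm] using this
  rw [hx, h3, intervalIntegral.integral_eq_sub_of_hasDerivAt (fun t _ => hd t)
    (Continuous.intervalIntegrable (by fun_prop) _ _)]
  simp

theorem norm_expo_sq {κ : ℂ} (hκ : 0 < κ.re) (e : F) :
    2 * κ.re * ‖expo κ hκ e‖ ^ 2 = ‖e‖ ^ 2 := by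
  have h := two_mul_re_inner_of_mem_sobolevGraph_Ioi (expo_mem_sobolevGraph hκ e)
  simp only [inner_smul_right, LinearPMap.inner_self_eq_ofReal, Complex.re_mul_ofReal,
    Complex.neg_re] at h
  linarith

theorem continuous_expo {κ : ℂ} (hκ : 0 < κ.re) : Continuous (expo κ hκ : F →ₗ[ℂ] L2 (Ioi 0) F) := by
  refine AddMonoidHomClass.continuous_of_bound _ (Real.sqrt (2 * κ.re)⁻¹) fun e => ?_
  have h := norm_expo_sq hκ e
  rw [← Real.sqrt_sq (norm_nonneg e), ← Real.sqrt_mul (by positivity)]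
  apply Real.le_sqrt_of_sq_le
  rw [← h, inv_mul_cancel_left₀ (by positivity)]

/-- Injectivity of the Fourier transform on `L¹`. -/
theorem ae_eq_zero_of_fourier_eq_zero {f : ℝ → F} (hf : Integrable f)
    (h : ∀ ξ, FourierTransform.fourier f ξ = 0) : f =ᵐ[volume] 0 := by
  refine ae_eq_zero_of_integral_contDiff_smul_eq_zero hf.locallyIntegrable fun g hg hgc => ?_
  have hg₁ : HasCompactSupport (Complex.ofRealCLM ∘ g) := hgc.comp_left rfl
  have hg₂ : ContDiff ℝ ((⊤ : ℕ∞) : WithTop ℕ∞) (Complex.ofRealCLM ∘ g) := by fun_prop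
  let φ : SchwartzMap ℝ ℂ := hg₁.toSchwartzMap hg₂
  let ψ : SchwartzMap ℝ ℂ := FourierTransformInv.fourierInv φ
  have hψ : FourierTransform.fourier (ψ : ℝ → ℂ) = φ := by
    rw [← SchwartzMap.fourier_coe, FourierTransform.fourier_fourierInv_eq]
  have hflip := VectorFourier.integral_fourierIntegral_smul_eq_flip (L := innerₗ ℝ)
    (μ := volume) (ν := volume) Real.continuous_fourierChar continuous_inner ψ.integrable hf
  have e1 : ∫ x, g x • f x = ∫ x, FourierTransform.fourier (ψ : ℝ → ℂ) x • f x := by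
    rw [hψ]
    rfl
  have e2 : ∫ x, ψ x • FourierTransform.fourier f x = 0 := by simp [h]
  rw [e1, ← e2]
  simpa using! hflip

/-- The exponentials `exp(-κ x) e` with a fixed `Re κ` are complete in `L²` of the half-line. -/
theorem eq_zero_of_inner_expo_eq_zero {t : ℝ} (ht : 0 < t) {g : L2 (Ioi 0) F}
    (h : ∀ (κ : ℂ) (hκ : 0 < κ.re), κ.re = t → ∀ e, inner ℂ (expo κ hκ e) g = 0) : g = 0 := by
  set ψ : ℝ → F := (Ioi (0 : ℝ)).indicator fun x => Complex.exp (-t * x) • g x with hψ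
  have hint : IntegrableOn (fun x : ℝ => Complex.exp (-t * x) • g x) (Ioi 0) := by
    have h1 := memLp_cexp_smul (κ := t) (by simpa using ht) (1 : ℂ)
    simpa using! memLp_one_iff_integrable.mp ((Lp.memLp g).smul h1 (r := 1))
  have hψi : Integrable ψ := hint.integrable_indicator measurableSet_Ioi
  have hF : ∀ ξ, FourierTransform.fourier ψ ξ = 0 := by
    intro ξ
    refine ext_inner_left ℂ fun e => ?_
    have hi := (Real.fourierIntegral_convergent_iff (μ := volume) ξ).mpr hψi
    rw [Real.fourier_eq, ← integral_inner hi, inner_zero_right]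
    have h1 := h (t - 2 * Real.pi * Complex.I * ξ) (by simpa using ht) (by simp) e
    rw [inner_expo, ← integral_indicator measurableSet_Ioi] at h1
    rw [← h1]
    refine integral_congr_ae (Eventually.of_forall fun x => ?_)
    by_cases hx : x ∈ Ioi (0 : ℝ)
    · simp only [hψ, indicator_of_mem hx, Circle.smul_def, Real.fourierChar_apply,
        inner_smul_right, ← mul_assoc, ← Complex.exp_add]
      congr 2
      simp
      ring
    · simp [hψ, indicator_of_notMem hx]
  have hz := ae_eq_zero_of_fourier_eq_zero hψi hF
  refine Lp.ext ?_
  have hz' := ae_restrict_of_ae (s := Ioi (0 : ℝ)) hz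
  filter_upwards [hz', ae_restrict_mem measurableSet_Ioi, Lp.coeFn_zero F 2
    (volume.restrict (Ioi (0 : ℝ)))] with x hx hx0 hx1
  rw [hx1]
  rw [hψ, indicator_of_mem hx0] at hx
  simpa using hx

/-! ### Resolvents of the derivative on the half-line -/

/-- The equation `v' + κ v = g` has a solution `v` of class `H¹` on `(0, ∞)` for every `g`, if
`Re κ ≠ 0`; if `Re κ > 0` then it can be chosen with `v(0) = 0`. By Green's formula the operator
`v ↦ v' + κ v` is bounded from below, so that its range is closed, and it is dense since it
contains exponentials. -/
theorem exists_mem_sobolevGraph_Ioi_of_re_ne_zero {κ : ℂ} (hκ : κ.re ≠ 0) (g : L2 (Ioi 0) F) :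
    ∃ (v : L2 (Ioi 0) F) (e : F), (v, (e, -κ • v + g)) ∈ sobolevGraph (Ioi 0) F ∧
      (0 < κ.re → e = 0) := by
  let K : Submodule ℂ (L2 (Ioi 0) F × (F × L2 (Ioi 0) F)) :=
    { carrier := {p | p ∈ sobolevGraph (Ioi 0) F ∧ (0 < κ.re → p.2.1 = 0)}
      zero_mem' := ⟨Submodule.zero_mem _, fun _ => rfl⟩
      add_mem' := fun hp hq => ⟨Submodule.add_mem _ hp.1 hq.1, fun h => by
        simp [hp.2 h, hq.2 h]⟩
      smul_mem' := fun c _ hp => ⟨Submodule.smul_mem _ c hp.1, fun h => by simp [hp.2 h]⟩ }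
  have hK : IsClosed (K : Set (L2 (Ioi 0) F × (F × L2 (Ioi 0) F))) := by
    have h1 : IsClosed {p : L2 (Ioi 0) F × (F × L2 (Ioi 0) F) | 0 < κ.re → p.2.1 = 0} := by
      by_cases h : 0 < κ.re
      · simpa only [h, forall_true_left] using isClosed_eq (by fun_prop) continuous_const
      · simp [h]
    exact isClosed_sobolevGraph_Ioi.inter h1
  have : CompleteSpace K := hK.completeSpace_coe
  let T : K →L[ℂ] L2 (Ioi 0) F :=
    ((ContinuousLinearMap.snd ℂ F (L2 (Ioi 0) F)).comp
      (ContinuousLinearMap.snd ℂ (L2 (Ioi 0) F) (F × L2 (Ioi 0) F))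
      + κ • ContinuousLinearMap.fst ℂ (L2 (Ioi 0) F) (F × L2 (Ioi 0) F)).comp K.subtypeL
  have hT : ∀ p : K, T p = p.1.2.2 + κ • p.1.1 := fun _ => rfl
  set r := |κ.re| with hr
  have hr0 : 0 < r := abs_pos.mpr hκ
  have hbd : ∀ p : K,
      ‖p‖ ≤ (Real.toNNReal (r⁻¹ + (Real.sqrt (2 * r⁻¹) + (1 + ‖κ‖ * r⁻¹))) : ℝ) * ‖T p‖ := by
    rintro ⟨⟨v, e, g⟩, hp, hp0⟩
    rw [hT]
    simp only at hp0 ⊢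
    set f := g + κ • v with hf
    have hgr := two_mul_re_inner_of_mem_sobolevGraph_Ioi hp
    simp only at hgr
    have hvf : (inner ℂ v f).re = -‖e‖ ^ 2 / 2 + κ.re * ‖v‖ ^ 2 := by
      rw [hf, inner_add_right, inner_smul_right, LinearPMap.inner_self_eq_ofReal, Complex.add_re,
        Complex.re_mul_ofReal]
      linarith
    have hcs : |(inner ℂ v f).re| ≤ ‖v‖ * ‖f‖ :=
      (Complex.abs_re_le_norm _).trans (norm_inner_le_norm v f)
    have hmain : r * ‖v‖ ^ 2 + ‖e‖ ^ 2 / 2 ≤ ‖v‖ * ‖f‖ := by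
      rcases lt_or_gt_of_ne hκ with h | h
      · rw [hr, abs_of_neg h]
        have := neg_le_abs (inner ℂ v f).re
        linarith
      · rw [hr, abs_of_pos h, hp0 h]
        have := le_abs_self (inner ℂ v f).re
        rw [hvf, hp0 h] at this
        rw [hvf, hp0 h] at hcs
        simp only [norm_zero] at *
        linarith
    have hv : ‖v‖ ≤ r⁻¹ * ‖f‖ := by
      rw [inv_mul_eq_div, le_div_iff₀' hr0]
      rcases (norm_nonneg v).eq_or_lt with h0 | h0
      · rw [← h0]
        simp
      · refine le_of_mul_le_mul_left ?_ h0
        nlinarith [sq_nonneg ‖e‖]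
    have he : ‖e‖ ≤ Real.sqrt (2 * r⁻¹) * ‖f‖ := by
      rw [← Real.sqrt_sq (norm_nonneg f), ← Real.sqrt_mul (by positivity)]
      apply Real.le_sqrt_of_sq_le
      have h1 : ‖v‖ * ‖f‖ ≤ r⁻¹ * ‖f‖ * ‖f‖ := by gcongr
      have h2 : 0 ≤ r * ‖v‖ ^ 2 := by positivity
      nlinarith
    have hg : ‖g‖ ≤ (1 + ‖κ‖ * r⁻¹) * ‖f‖ := by
      have : g = f - κ • v := by rw [hf]; abel
      calc ‖g‖ = ‖f - κ • v‖ := by rw [← this]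
        _ ≤ ‖f‖ + ‖κ‖ * ‖v‖ := (norm_sub_le _ _).trans_eq (by rw [norm_smul])
        _ ≤ ‖f‖ + ‖κ‖ * (r⁻¹ * ‖f‖) := by gcongr
        _ = _ := by ring
    have hf0 := norm_nonneg f
    have hs0 := Real.sqrt_nonneg (2 * r⁻¹)
    rw [Real.coe_toNNReal _ (by positivity), add_mul, add_mul]
    have p1 : 0 ≤ r⁻¹ * ‖f‖ := by positivity
    have p2 : 0 ≤ Real.sqrt (2 * r⁻¹) * ‖f‖ := by positivity
    have p3 : 0 ≤ (1 + ‖κ‖ * r⁻¹) * ‖f‖ := by positivity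
    refine max_le ?_ (max_le ?_ ?_)
    · exact hv.trans (by linarith)
    · exact he.trans (by linarith)
    · exact hg.trans (by linarith)
  have hcl : IsClosed (range T) :=
    (AddMonoidHomClass.antilipschitz_of_bound T hbd).isClosed_range T.uniformContinuous
  have : CompleteSpace (LinearMap.range T.toLinearMap) := hcl.completeSpace_coe
  have htop : LinearMap.range T.toLinearMap = ⊤ := by
    rw [← Submodule.orthogonal_eq_bot_iff, Submodule.eq_bot_iff]
    intro w hw
    refine eq_zero_of_inner_expo_eq_zero (t := |κ.re| + 1) (by positivity) fun κ' hκ' hre e => ?_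
    have hne : κ - κ' ≠ 0 := by
      intro h0
      rw [sub_eq_zero.mp h0] at hre
      linarith [le_abs_self κ'.re]
    refine Submodule.inner_right_of_mem_orthogonal ?_ hw
    by_cases h : 0 < κ.re
    · have hm := Submodule.smul_mem _ (κ - κ')⁻¹ (Submodule.sub_mem _
        (expo_mem_sobolevGraph hκ' e) (expo_mem_sobolevGraph h e))
      refine ⟨⟨_, hm, fun _ => by simp⟩, ?_⟩
      change (κ - κ')⁻¹ • (-κ' • expo κ' hκ' e - -κ • expo κ h e)
        + κ • (κ - κ')⁻¹ • (expo κ' hκ' e - expo κ h e) = expo κ' hκ' e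
      have : (κ - κ')⁻¹ * (κ - κ') = 1 := inv_mul_cancel₀ hne
      refine Eq.trans ?_ (one_smul ℂ _)
      rw [← this]
      module
    · have hm := Submodule.smul_mem _ (κ - κ')⁻¹ (expo_mem_sobolevGraph hκ' e)
      refine ⟨⟨_, hm, fun h' => absurd h' h⟩, ?_⟩
      change (κ - κ')⁻¹ • (-κ' • expo κ' hκ' e) + κ • (κ - κ')⁻¹ • expo κ' hκ' e = expo κ' hκ' e
      have : (κ - κ')⁻¹ * (κ - κ') = 1 := inv_mul_cancel₀ hne
      refine Eq.trans ?_ (one_smul ℂ _)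
      rw [← this]
      module
  obtain ⟨⟨⟨v, e, g'⟩, hp, hp0⟩, hTp⟩ := LinearMap.range_eq_top.mp htop g
  refine ⟨v, e, ?_, hp0⟩
  have hg : g' + κ • v = g := hTp
  have : -κ • v + g = g' := by rw [← hg, neg_smul]; abel
  rwa [this]

theorem exists_mem_sobolevGraph_Ioi_of_re_neg {κ : ℂ} (hκ : κ.re < 0) (g : L2 (Ioi 0) F) :
    ∃ (v : L2 (Ioi 0) F) (e : F), (v, (e, -κ • v + g)) ∈ sobolevGraph (Ioi 0) F := by
  obtain ⟨v, e, h, -⟩ := exists_mem_sobolevGraph_Ioi_of_re_ne_zero hκ.ne g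
  exact ⟨v, e, h⟩

theorem exists_mem_sobolevGraph_Ioi_of_re_pos {κ : ℂ} (hκ : 0 < κ.re) (g : L2 (Ioi 0) F) (e : F) :
    ∃ v : L2 (Ioi 0) F, (v, (e, -κ • v + g)) ∈ sobolevGraph (Ioi 0) F := by
  obtain ⟨v, e', h, he⟩ := exists_mem_sobolevGraph_Ioi_of_re_ne_zero hκ.ne' g
  obtain rfl := he hκ
  refine ⟨v + expo κ hκ e, ?_⟩
  have := Submodule.add_mem _ h (expo_mem_sobolevGraph hκ e)
  simp only [Prod.mk_add_mk, zero_add] at this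
  convert this using 3
  rw [smul_add]
  abel

end Exponential

/-! ### Reflection -/

section Reflection

variable {F : Type*} [NormedAddCommGroup F] [InnerProductSpace ℂ F] {s t : Set ℝ}

theorem measurePreserving_neg_restrict (hs : MeasurableSet s) (hst : ∀ x, x ∈ t ↔ -x ∈ s) :
    MeasurePreserving (fun x : ℝ => -x) (volume.restrict t) (volume.restrict s) := by
  have h := (Measure.measurePreserving_neg (volume : Measure ℝ)).restrict_preimage hs
  have ht : Neg.neg ⁻¹' s = t := ext fun x => (hst x).symm
  rwa [ht] at h

/-- The reflection `v ↦ v(-·)`, from `L²(s)` to `L²(t)` with `t = -s`. -/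
noncomputable def reflect (hs : MeasurableSet s) (hst : ∀ x, x ∈ t ↔ -x ∈ s) :
    L2 s F →ₗᵢ[ℂ] L2 t F :=
  Lp.compMeasurePreservingₗᵢ ℂ _ (measurePreserving_neg_restrict hs hst)

theorem coeFn_reflect (hs : MeasurableSet s) (hst : ∀ x, x ∈ t ↔ -x ∈ s) (v : L2 s F) :
    reflect hs hst v =ᵐ[volume.restrict t] fun x => v (-x) :=
  Lp.coeFn_compMeasurePreserving v (measurePreserving_neg_restrict hs hst)

theorem reflect_reflect (hs : MeasurableSet s) (hst : ∀ x, x ∈ t ↔ -x ∈ s) (ht : MeasurableSet t)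
    (hts : ∀ x, x ∈ s ↔ -x ∈ t) (v : L2 s F) : reflect ht hts (reflect hs hst v) = v := by
  refine Lp.ext ?_
  have h1 := (measurePreserving_neg_restrict ht hts).quasiMeasurePreserving.ae
    (coeFn_reflect hs hst v)
  filter_upwards [coeFn_reflect ht hts (reflect hs hst v), h1] with x hx hx1
  rw [hx, hx1, neg_neg]

theorem integral_restrict_eq_indicator (hs : MeasurableSet s) (g : ℝ → F) (a b : ℝ) :
    ∫ x in a..b, g x ∂(volume.restrict s) = ∫ x in a..b, s.indicator g x := by
  simp only [intervalIntegral, setIntegral_indicator hs,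
    Measure.restrict_restrict measurableSet_Ioc]

theorem reflect_mem_sobolevGraph (hs : MeasurableSet s) (hst : ∀ x, x ∈ t ↔ -x ∈ s)
    (ht : MeasurableSet t) {v g : L2 s F} {e : F} (h : (v, (e, g)) ∈ sobolevGraph s F) :
    (reflect hs hst v, (e, -reflect hs hst g)) ∈ sobolevGraph t F := by
  have hv : ∀ᵐ x ∂(volume.restrict s), v x = e + ∫ y in (0 : ℝ)..x, g y ∂(volume.restrict s) := h
  change ∀ᵐ x ∂(volume.restrict t), reflect hs hst v x
    = e + ∫ y in (0 : ℝ)..x, (-reflect hs hst g : L2 t F) y ∂(volume.restrict t)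
  have hg : ∀ x, ∫ y in (0 : ℝ)..x, (-reflect hs hst g : L2 t F) y ∂(volume.restrict t)
      = ∫ y in (0 : ℝ)..(-x), g y ∂(volume.restrict s) := by
    intro x
    have h1 : ∫ y in (0 : ℝ)..x, (-reflect hs hst g : L2 t F) y ∂(volume.restrict t)
        = ∫ y in (0 : ℝ)..x, -g (-y) ∂(volume.restrict t) := by
      have h2 : ∀ᵐ y ∂(volume.restrict t), (-reflect hs hst g : L2 t F) y = -g (-y) := by
        filter_upwards [Lp.coeFn_neg (reflect hs hst g), coeFn_reflect hs hst g] with y h2 h3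
        rw [h2, Pi.neg_apply, h3]
      exact intervalIntegral.integral_congr_ae' (h2.mono fun _ h _ => h) (h2.mono fun _ h _ => h)
    have h3 : t.indicator (fun y => -g (-y)) = fun y => -s.indicator g (-y) := by
      funext y
      by_cases hy : y ∈ t
      · rw [indicator_of_mem hy, indicator_of_mem ((hst y).mp hy)]
      · rw [indicator_of_notMem hy, indicator_of_notMem fun h => hy ((hst y).mpr h), neg_zero]
    rw [h1, integral_restrict_eq_indicator ht, integral_restrict_eq_indicator hs, h3,
      intervalIntegral.integral_neg, intervalIntegral.integral_comp_neg, neg_zero,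
      intervalIntegral.integral_symm, neg_neg]
  filter_upwards [coeFn_reflect hs hst v,
    (measurePreserving_neg_restrict hs hst).quasiMeasurePreserving.ae hv] with x hx1 hx2
  rw [hx1, hx2, hg]

/-- The reflection from `(0, ∞)` to `(-∞, 0)`. -/
noncomputable def toMinus : L2 (Ioi 0) F →ₗᵢ[ℂ] L2 (Iio 0) F :=
  reflect measurableSet_Ioi fun x => by simp

/-- The reflection from `(-∞, 0)` to `(0, ∞)`. -/
noncomputable def toPlus : L2 (Iio 0) F →ₗᵢ[ℂ] L2 (Ioi 0) F :=
  reflect measurableSet_Iio fun x => by simp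

theorem toMinus_toPlus (v : L2 (Iio 0) F) : toMinus (toPlus v) = v :=
  reflect_reflect _ _ _ _ v

theorem toMinus_mem_sobolevGraph {v g : L2 (Ioi 0) F} {e : F}
    (h : (v, (e, g)) ∈ sobolevGraph (Ioi 0) F) :
    (toMinus v, (e, -toMinus g)) ∈ sobolevGraph (Iio 0) F :=
  reflect_mem_sobolevGraph _ _ measurableSet_Iio h

theorem toPlus_mem_sobolevGraph {v g : L2 (Iio 0) F} {e : F}
    (h : (v, (e, g)) ∈ sobolevGraph (Iio 0) F) :
    (toPlus v, (e, -toPlus g)) ∈ sobolevGraph (Ioi 0) F :=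
  reflect_mem_sobolevGraph _ _ measurableSet_Ioi h

variable [CompleteSpace F]

/-- Green's formula on `(-∞, 0)`: `2 Re ⟨v, v'⟩ = ‖v(0)‖²` for `v` of class `H¹`. -/
theorem two_mul_re_inner_of_mem_sobolevGraph_Iio {p : L2 (Iio 0) F × (F × L2 (Iio 0) F)}
    (hp : p ∈ sobolevGraph (Iio 0) F) : 2 * (inner ℂ p.1 p.2.2).re = ‖p.2.1‖ ^ 2 := by
  obtain ⟨v, e, g⟩ := p
  have h := two_mul_re_inner_of_mem_sobolevGraph_Ioi (toPlus_mem_sobolevGraph hp)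
  have h1 : inner ℂ (toPlus v) (-toPlus g) = -inner ℂ v g := by
    rw [inner_neg_right, LinearIsometry.inner_map_map]
  rw [h1, Complex.neg_re] at h
  change 2 * (inner ℂ v g).re = ‖e‖ ^ 2
  change 2 * -(inner ℂ v g).re = -‖e‖ ^ 2 at h
  linarith

theorem exists_mem_sobolevGraph_Iio_of_re_pos {κ : ℂ} (hκ : 0 < κ.re) (g : L2 (Iio 0) F) :
    ∃ (v : L2 (Iio 0) F) (e : F), (v, (e, -κ • v + g)) ∈ sobolevGraph (Iio 0) F := by
  obtain ⟨v, e, h⟩ := exists_mem_sobolevGraph_Ioi_of_re_neg (κ := -κ) (by simpa using hκ)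
    (-toPlus g)
  refine ⟨toMinus v, e, ?_⟩
  simpa [toMinus_toPlus, add_comm] using toMinus_mem_sobolevGraph h

theorem exists_mem_sobolevGraph_Iio_of_re_neg {κ : ℂ} (hκ : κ.re < 0) (g : L2 (Iio 0) F) (e : F) :
    ∃ v : L2 (Iio 0) F, (v, (e, -κ • v + g)) ∈ sobolevGraph (Iio 0) F := by
  obtain ⟨v, h⟩ := exists_mem_sobolevGraph_Ioi_of_re_pos (κ := -κ) (by simpa using hκ)
    (-toPlus g) e
  refine ⟨toMinus v, ?_⟩
  simpa [toMinus_toPlus, add_comm] using toMinus_mem_sobolevGraph h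

end Reflection

/-! ### Boundary values and derivatives as functions -/

section Jet

variable {F : Type*} [NormedAddCommGroup F] [InnerProductSpace ℂ F] [CompleteSpace F] {s : Set ℝ}

theorem graph_jet (hs : IsOpen s) (h0 : (0 : ℝ) ∈ closure s) :
    (jet s F).graph = sobolevGraph s F :=
  Submodule.toLinearPMap_graph_eq _ (sobolevGraph_unique hs h0)

theorem graph_jet_Ioi : (jet (Ioi 0) F).graph = sobolevGraph (Ioi 0) F :=
  graph_jet isOpen_Ioi (by simp)

theorem graph_jet_Iio : (jet (Iio 0) F).graph = sobolevGraph (Iio 0) F :=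
  graph_jet isOpen_Iio (by simp)

end Jet

/-! ### Consequences of the completeness of the exponentials -/

section Completeness

variable {F D H : Type*} [NormedAddCommGroup F] [InnerProductSpace ℂ F] [CompleteSpace F]
  [NormedAddCommGroup H] [InnerProductSpace ℂ H]

theorem eq_zero_of_forall_inner_expo_eq_zero {γ : D → F} (hγ : DenseRange γ)
    {g : L2 (Ioi 0) F}
    (h : ∀ (κ : ℂ) (hκ : 0 < κ.re) (x : D), inner ℂ (expo κ hκ (γ x)) g = 0) : g = 0 := by
  refine eq_zero_of_inner_expo_eq_zero one_pos fun κ hκ _ e => ?_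
  exact hγ.induction_on (p := fun e => inner ℂ (expo κ hκ e) g = 0) e
    (isClosed_eq ((continuous_expo hκ).inner continuous_const) continuous_const) (h κ hκ)

/-- Since `‖exp(-κ ·) e‖` tends to `0` as `κ → ∞`, only the constant term remains in the limit. -/
theorem eq_zero_of_add_inner_expo_eq_zero {q : ℂ} {e : F} {g : L2 (Ioi 0) F}
    (h : ∀ (κ : ℂ) (hκ : 0 < κ.re), q + inner ℂ (expo κ hκ e) g = 0) : q = 0 := by
  by_contra hq
  have hpos : 0 < ‖q‖ ^ 2 := by positivity
  have hle : ∀ τ : ℝ, 0 < τ → 2 * τ * ‖q‖ ^ 2 ≤ ‖e‖ ^ 2 * ‖g‖ ^ 2 := by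
    intro τ hτ
    have hτ' : 0 < (τ : ℂ).re := by simpa using hτ
    have h1 : ‖q‖ ≤ ‖expo (τ : ℂ) hτ' e‖ * ‖g‖ := by
      rw [eq_neg_of_add_eq_zero_left (h τ hτ'), norm_neg]
      exact norm_inner_le_norm _ _
    have h2 := norm_expo_sq hτ' e
    rw [Complex.ofReal_re] at h2
    calc 2 * τ * ‖q‖ ^ 2 ≤ 2 * τ * (‖expo (τ : ℂ) hτ' e‖ * ‖g‖) ^ 2 := by gcongr
      _ = (2 * τ * ‖expo (τ : ℂ) hτ' e‖ ^ 2) * ‖g‖ ^ 2 := by ring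
      _ = _ := by rw [h2]
  have h3 := hle ((‖e‖ ^ 2 * ‖g‖ ^ 2 + 1) / ‖q‖ ^ 2) (by positivity)
  rw [mul_assoc, div_mul_cancel₀ _ hpos.ne'] at h3
  have : 0 ≤ ‖e‖ ^ 2 * ‖g‖ ^ 2 := by positivity
  linarith

end Completeness

end Channel

namespace Dilation

open Channel
open LinearPMap (shift_apply shift_resolventMap resolventMap_shift apply_resolventMap)

variable {H E Es : Type*}
  [NormedAddCommGroup H] [InnerProductSpace ℂ H] [CompleteSpace H]
  [NormedAddCommGroup E] [InnerProductSpace ℂ E] [CompleteSpace E]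
  [NormedAddCommGroup Es] [InnerProductSpace ℂ Es] [CompleteSpace Es]
  {A : H →ₗ.[ℂ] H} {Γ : A.domain →ₗ[ℂ] E} {Γs : A.adjoint.domain →ₗ[ℂ] Es} {lam mu : ℂ}

/-! ### The graph of the dilation -/

theorem opT_mem_boundaryRelation (hA : A.IsMaximalDissipative)
    (hΓ : A.IsLagrangeOperator Complex.I Γ)
    (hΓs : A.adjoint.IsLagrangeOperator (-Complex.I) Γs) (hlam : 0 < lam.im)
    (U : domain A Γ Γs lam mu) :
    (((U : Space H E Es).snd.fst, opT A Γ Γs lam mu U), bdryMinus (toChannel A Γ Γs lam mu U),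
      bdryPlus (toChannel A Γ Γs lam mu U)) ∈ boundaryRelation A Γ Γs :=
  (mem_boundaryRelation_iff_plus hA hΓ hΓs hlam _ _ _ _).mpr
    ⟨U.2.2.mem_adjoint_domain, rfl, U.2.2.condII⟩

theorem opT_eq_opTstar (hA : A.IsMaximalDissipative) (hΓ : A.IsLagrangeOperator Complex.I Γ)
    (hΓs : A.adjoint.IsLagrangeOperator (-Complex.I) Γs) (hlam : 0 < lam.im) (hmu : mu.im < 0) :
    opT A Γ Γs lam mu = opTstar A Γ Γs lam mu := by
  ext U
  obtain ⟨_, h, -⟩ := (mem_boundaryRelation_iff_minus hA hΓ hΓs hmu _ _ _ _).mp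
    (opT_mem_boundaryRelation (lam := lam) (mu := mu) hA hΓ hΓs hlam U)
  exact h

/-- The graph of the dilation, in terms of the boundary relation. -/
theorem mem_graph_operator_iff (hA : A.IsMaximalDissipative)
    (hΓ : A.IsLagrangeOperator Complex.I Γ)
    (hΓs : A.adjoint.IsLagrangeOperator (-Complex.I) Γs) (hlam : 0 < lam.im) (hmu : mu.im < 0)
    (U W : Space H E Es) :
    (U, W) ∈ (operator A Γ Γs lam mu).graph ↔
      ∃ (em : Es) (gm : L2 (Iio 0) Es) (ep : E) (gp : L2 (Ioi 0) E),
        (U.fst, (em, gm)) ∈ sobolevGraph (Iio 0) Es ∧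
        (U.snd.snd, (ep, gp)) ∈ sobolevGraph (Ioi 0) E ∧
        ((U.snd.fst, W.snd.fst), em, ep) ∈ boundaryRelation A Γ Γs ∧
        W.fst = Complex.I • gm ∧ W.snd.snd = Complex.I • gp := by
  rw [← graph_jet_Iio, ← graph_jet_Ioi]
  constructor
  · rintro h
    obtain ⟨U, rfl, rfl⟩ := (LinearPMap.mem_graph_iff _).mp h
    exact ⟨_, _, _, _, (jet (Iio 0) Es).mem_graph ⟨_, U.2.1.1⟩,
      (jet (Ioi 0) E).mem_graph ⟨_, U.2.1.2⟩,
      opT_mem_boundaryRelation hA hΓ hΓs hlam U, rfl, rfl⟩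
  · rintro ⟨em, gm, ep, gp, h1, h2, h3, h4, h5⟩
    have hU : U ∈ channelDomain H E Es :=
      ⟨LinearPMap.mem_domain_of_mem_graph h1, LinearPMap.mem_domain_of_mem_graph h2⟩
    have hjm : jetMinus (⟨U, hU⟩ : channelDomain H E Es) = (em, gm) :=
      LinearPMap.mem_graph_snd_inj _ ((jet (Iio 0) Es).mem_graph ⟨_, hU.1⟩) h1 rfl
    have hjp : jetPlus (⟨U, hU⟩ : channelDomain H E Es) = (ep, gp) :=
      LinearPMap.mem_graph_snd_inj _ ((jet (Ioi 0) E).mem_graph ⟨_, hU.2⟩) h2 rfl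
    have hbm : bdryMinus (⟨U, hU⟩ : channelDomain H E Es) = em := congrArg Prod.fst hjm
    have hbp : bdryPlus (⟨U, hU⟩ : channelDomain H E Es) = ep := congrArg Prod.fst hjp
    have hdm : derivMinus (⟨U, hU⟩ : channelDomain H E Es) = gm := congrArg Prod.snd hjm
    have hdp : derivPlus (⟨U, hU⟩ : channelDomain H E Es) = gp := congrArg Prod.snd hjp
    rw [← hbm, ← hbp] at h3
    obtain ⟨hm, -, hI⟩ := (mem_boundaryRelation_iff_minus hA hΓ hΓs hmu _ _ _ _).mp h3
    obtain ⟨hp, hf, hII⟩ := (mem_boundaryRelation_iff_plus hA hΓ hΓs hlam _ _ _ _).mp h3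
    have hdom : U ∈ domain A Γ Γs lam mu := ⟨hU, ⟨hm, hp, hI, hII⟩⟩
    rw [LinearPMap.mem_graph_iff]
    refine ⟨⟨U, hdom⟩, rfl, ?_⟩
    change WithLp.toLp 2 (Complex.I • derivMinus (⟨U, hU⟩ : channelDomain H E Es),
        WithLp.toLp 2 (opT A Γ Γs lam mu ⟨U, hdom⟩,
          Complex.I • derivPlus (⟨U, hU⟩ : channelDomain H E Es))) = W
    have hT : opT A Γ Γs lam mu ⟨U, hdom⟩ = W.snd.fst := hf.symm
    rw [hdm, hdp, hT, ← h4, ← h5]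
    rfl

/-! ### The resolvents of the dilation -/

theorem im_inner_operator (hA : A.IsMaximalDissipative) (hΓ : A.IsLagrangeOperator Complex.I Γ)
    (hΓs : A.adjoint.IsLagrangeOperator (-Complex.I) Γs) (hlam : 0 < lam.im) (hmu : mu.im < 0)
    (U : (operator A Γ Γs lam mu).domain) :
    (inner ℂ (U : Space H E Es) (operator A Γ Γs lam mu U)).im = 0 := by
  obtain ⟨em, gm, ep, gp, h1, h2, h3, h4, h5⟩ := (mem_graph_operator_iff hA hΓ hΓs hlam hmu _ _).mp
    ((operator A Γ Γs lam mu).mem_graph U)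
  have g1 := two_mul_re_inner_of_mem_sobolevGraph_Iio h1
  have g2 := two_mul_re_inner_of_mem_sobolevGraph_Ioi h2
  have g3 := two_mul_im_inner_of_mem_boundaryRelation hA hΓ hΓs h3
  simp only at g1 g2
  rw [WithLp.prod_inner_apply, WithLp.prod_inner_apply]
  change (inner ℂ (U : Space H E Es).fst (operator A Γ Γs lam mu U).fst
    + (inner ℂ (U : Space H E Es).snd.fst (operator A Γ Γs lam mu U).snd.fst
      + inner ℂ (U : Space H E Es).snd.snd (operator A Γ Γs lam mu U).snd.snd)).im = 0
  rw [h4, h5, inner_smul_right, inner_smul_right, Complex.add_im, Complex.add_im, Complex.I_mul_im,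
    Complex.I_mul_im]
  linarith

theorem exists_mem_boundaryRelation_of_im_neg (hA : A.IsMaximalDissipative)
    (hΓ : A.IsLagrangeOperator Complex.I Γ)
    (hΓs : A.adjoint.IsLagrangeOperator (-Complex.I) Γs) {z : ℂ} (hz : z.im < 0) (h : H) (em : Es) :
    ∃ u ep, ((u, h + z • u), em, ep) ∈ boundaryRelation A Γ Γs := by
  -- The parameter `μ` of the description of the relation is free: take `μ = -z̄`.
  have hmu : (-star z).im < 0 := by simpa using hz
  set G := A.adjoint.gammaField Γs (-(-star z)) em with hG
  have hR : (A.resolventMap z h : H) - G + G = A.resolventMap z h := sub_add_cancel _ _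
  refine ⟨A.resolventMap z h - G, _, (mem_boundaryRelation_iff_minus hA hΓ hΓs hmu _ _ _ _).mpr
    ⟨?_, ?_, rfl⟩⟩
  · rw [← hG, hR]
    exact (A.resolventMap z h).2
  · simp only [← hG, hR]
    rw [apply_resolventMap (hA.mem_resolventSet hz), star_neg, star_star, smul_sub, neg_smul]
    abel

theorem exists_mem_boundaryRelation_of_im_pos (hA : A.IsMaximalDissipative)
    (hΓ : A.IsLagrangeOperator Complex.I Γ)
    (hΓs : A.adjoint.IsLagrangeOperator (-Complex.I) Γs) {z : ℂ} (hz : 0 < z.im) (h : H) (ep : E) :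
    ∃ u em, ((u, h + z • u), em, ep) ∈ boundaryRelation A Γ Γs := by
  -- The parameter `λ` of the description of the relation is free: take `λ = -z̄`.
  have hlam : 0 < (-star z).im := by simpa using hz
  set G := A.gammaField Γ (-(-star z)) ep with hG
  have hR : (A.adjoint.resolventMap z h : H) - G + G = A.adjoint.resolventMap z h :=
    sub_add_cancel _ _
  refine ⟨A.adjoint.resolventMap z h - G, _,
    (mem_boundaryRelation_iff_plus hA hΓ hΓs hlam _ _ _ _).mpr ⟨?_, ?_, rfl⟩⟩
  · rw [← hG, hR]
    exact (A.adjoint.resolventMap z h).2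
  · simp only [← hG, hR]
    rw [apply_resolventMap (hA.mem_resolventSet_adjoint hz), star_neg, star_star, smul_sub,
      neg_smul]
    abel

theorem add_smul_eq_I_smul {V : Type*} [AddCommGroup V] [Module ℂ V] (z : ℂ) (v f : V) :
    f + z • v = Complex.I • (-(Complex.I * z) • v + -(Complex.I • f)) := by
  have h1 : Complex.I * (Complex.I * z) = -z := by rw [← mul_assoc, Complex.I_mul_I, neg_one_mul]
  simp only [smul_add, smul_neg, neg_smul, smul_smul, h1, Complex.I_mul_I]
  simp [add_comm]

/-- The operator `L - z` is onto: for `Im z < 0` the equation on `(-∞, 0)` determines `v₋(0)`, the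
boundary relation then determines `u` and `v₊(0)`, and `v₊` solves an initial value problem; for
`Im z > 0` the order is reversed. -/
theorem exists_mem_graph_operator (hA : A.IsMaximalDissipative)
    (hΓ : A.IsLagrangeOperator Complex.I Γ)
    (hΓs : A.adjoint.IsLagrangeOperator (-Complex.I) Γs) (hlam : 0 < lam.im) (hmu : mu.im < 0)
    {z : ℂ} (hz : z.im ≠ 0) (W : Space H E Es) :
    ∃ U, (U, W + z • U) ∈ (operator A Γ Γs lam mu).graph := by
  rcases lt_or_gt_of_ne hz with hz | hz
  · have hκ : 0 < (Complex.I * z).re := by simpa using hz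
    obtain ⟨v, em, hv⟩ := exists_mem_sobolevGraph_Iio_of_re_pos hκ (-(Complex.I • W.fst))
    obtain ⟨u, ep, hu⟩ := exists_mem_boundaryRelation_of_im_neg hA hΓ hΓs hz W.snd.fst em
    obtain ⟨w, hw⟩ := exists_mem_sobolevGraph_Ioi_of_re_pos hκ (-(Complex.I • W.snd.snd)) ep
    refine ⟨WithLp.toLp 2 (v, WithLp.toLp 2 (u, w)), ?_⟩
    rw [mem_graph_operator_iff hA hΓ hΓs hlam hmu]
    exact ⟨em, _, ep, _, hv, hw, hu, add_smul_eq_I_smul z v W.fst, add_smul_eq_I_smul z w W.snd.snd⟩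
  · have hκ : (Complex.I * z).re < 0 := by simpa using hz
    obtain ⟨w, ep, hw⟩ := exists_mem_sobolevGraph_Ioi_of_re_neg hκ (-(Complex.I • W.snd.snd))
    obtain ⟨u, em, hu⟩ := exists_mem_boundaryRelation_of_im_pos hA hΓ hΓs hz W.snd.fst ep
    obtain ⟨v, hv⟩ := exists_mem_sobolevGraph_Iio_of_re_neg hκ (-(Complex.I • W.fst)) em
    refine ⟨WithLp.toLp 2 (v, WithLp.toLp 2 (u, w)), ?_⟩
    rw [mem_graph_operator_iff hA hΓ hΓs hlam hmu]
    exact ⟨em, _, ep, _, hv, hw, hu, add_smul_eq_I_smul z v W.fst, add_smul_eq_I_smul z w W.snd.snd⟩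

theorem mem_resolventSet_operator (hA : A.IsMaximalDissipative)
    (hΓ : A.IsLagrangeOperator Complex.I Γ)
    (hΓs : A.adjoint.IsLagrangeOperator (-Complex.I) Γs) (hlam : 0 < lam.im) (hmu : mu.im < 0)
    {z : ℂ} (hz : z.im ≠ 0) : z ∈ (operator A Γ Γs lam mu).resolventSet :=
  LinearPMap.mem_resolventSet_of_im_eq_zero (L := operator A Γ Γs lam mu)
    (im_inner_operator hA hΓ hΓs hlam hmu) hz
    (LinearPMap.surjective_shift_of_mem_graph
      (exists_mem_graph_operator hA hΓ hΓs hlam hmu hz))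

theorem isSelfAdjoint_operator (hA : A.IsMaximalDissipative)
    (hΓ : A.IsLagrangeOperator Complex.I Γ)
    (hΓs : A.adjoint.IsLagrangeOperator (-Complex.I) Γs) (hlam : 0 < lam.im) (hmu : mu.im < 0) :
    IsSelfAdjoint (operator A Γ Γs lam mu) :=
  LinearPMap.isSelfAdjoint_of_surjective_shift (im_inner_operator hA hΓ hΓs hlam hmu)
    fun _ hz => LinearPMap.surjective_shift_of_mem_graph
      (exists_mem_graph_operator hA hΓ hΓs hlam hmu hz)

/-- For `Im z < 0` the resolvent at `(0, h, 0)` with `h = (A - z) x` has no incoming component, and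
its outgoing component is the exponential `exp(-i z ·) i Γ x`. -/
theorem resolventMap_operator_of_im_neg (hA : A.IsMaximalDissipative)
    (hΓ : A.IsLagrangeOperator Complex.I Γ)
    (hΓs : A.adjoint.IsLagrangeOperator (-Complex.I) Γs) (hlam : 0 < lam.im) (hmu : mu.im < 0)
    {z : ℂ} (hz : z.im < 0) (hκ : 0 < (Complex.I * z).re) (x : A.domain) :
    ((operator A Γ Γs lam mu).resolventMap z (embed (A.shift z x)) : Space H E Es)
      = WithLp.toLp 2 (0, WithLp.toLp 2 ((x : H), expo (Complex.I * z) hκ (Complex.I • Γ x))) := by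
  apply LinearPMap.resolventMap_eq_of_mem_graph
    (mem_resolventSet_operator hA hΓ hΓs hlam hmu hz.ne)
  rw [mem_graph_operator_iff hA hΓ hΓs hlam hmu]
  refine ⟨0, 0, _, _, Submodule.zero_mem _, expo_mem_sobolevGraph hκ (Complex.I • Γ x), ?_, ?_, ?_⟩
  · have : A.shift z x + z • (x : H) = A x := by rw [shift_apply]; abel
    change (((x : H), A.shift z x + z • (x : H)), (0 : Es), Complex.I • Γ x) ∈ _
    rw [this]
    exact boundaryRelation_of_domain x
  · change (0 : L2 (Iio 0) Es) + z • (0 : L2 (Iio 0) Es) = Complex.I • (0 : L2 (Iio 0) Es)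
    simp
  · change (0 : L2 (Ioi 0) E) + z • expo (Complex.I * z) hκ (Complex.I • Γ x) = _
    have h1 : Complex.I * -(Complex.I * z) = z := by
      rw [mul_neg, ← mul_assoc, Complex.I_mul_I, neg_one_mul, neg_neg]
    rw [zero_add, smul_smul, h1]

/-- For `Im z > 0` the resolvent at `(0, h, 0)` with `h = (A* - z) y` has no outgoing component. -/
theorem resolventMap_operator_of_im_pos (hA : A.IsMaximalDissipative)
    (hΓ : A.IsLagrangeOperator Complex.I Γ)
    (hΓs : A.adjoint.IsLagrangeOperator (-Complex.I) Γs) (hlam : 0 < lam.im) (hmu : mu.im < 0)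
    {z : ℂ} (hz : 0 < z.im) (hκ : 0 < (-(Complex.I * z)).re) (y : A.adjoint.domain) :
    ((operator A Γ Γs lam mu).resolventMap z (embed (A.adjoint.shift z y)) : Space H E Es)
      = WithLp.toLp 2 (toMinus (expo (-(Complex.I * z)) hκ (-(Complex.I • Γs y))),
          WithLp.toLp 2 ((y : H), 0)) := by
  apply LinearPMap.resolventMap_eq_of_mem_graph
    (mem_resolventSet_operator hA hΓ hΓs hlam hmu hz.ne')
  rw [mem_graph_operator_iff hA hΓ hΓs hlam hmu]
  refine ⟨_, _, 0, 0, toMinus_mem_sobolevGraph (expo_mem_sobolevGraph hκ (-(Complex.I • Γs y))),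
    Submodule.zero_mem _, ?_, ?_, ?_⟩
  · have : A.adjoint.shift z y + z • (y : H) = A.adjoint y := by rw [shift_apply]; abel
    change (((y : H), A.adjoint.shift z y + z • (y : H)), -(Complex.I • Γs y), (0 : E)) ∈ _
    rw [this]
    exact boundaryRelation_of_adjoint_domain y
  · change (0 : L2 (Iio 0) Es)
      + z • toMinus (expo (-(Complex.I * z)) hκ (-(Complex.I • Γs y))) = _
    have h1 : Complex.I * (Complex.I * z) = -z := by
      rw [← mul_assoc, Complex.I_mul_I, neg_one_mul]
    rw [zero_add, neg_neg, (toMinus (F := Es)).map_smul, smul_neg, smul_smul, h1, neg_smul, neg_neg]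
  · change (0 : L2 (Ioi 0) E) + z • (0 : L2 (Ioi 0) E) = Complex.I • (0 : L2 (Ioi 0) E)
    simp

theorem mid_resolventMap_operator_of_im_neg (hA : A.IsMaximalDissipative)
    (hΓ : A.IsLagrangeOperator Complex.I Γ)
    (hΓs : A.adjoint.IsLagrangeOperator (-Complex.I) Γs) (hlam : 0 < lam.im) (hmu : mu.im < 0)
    {z : ℂ} (hz : z.im < 0) (h : H) :
    mid ((operator A Γ Γs lam mu).resolventMap z (embed h) : Space H E Es)
      = (A.resolventMap z h : H) := by
  have := resolventMap_operator_of_im_neg (lam := lam) (mu := mu) hA hΓ hΓs hlam hmu hz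
    (by simpa using hz) (A.resolventMap z h)
  rw [shift_resolventMap (hA.mem_resolventSet hz)] at this
  rw [this]
  rfl

theorem mid_resolventMap_operator_of_im_pos (hA : A.IsMaximalDissipative)
    (hΓ : A.IsLagrangeOperator Complex.I Γ)
    (hΓs : A.adjoint.IsLagrangeOperator (-Complex.I) Γs) (hlam : 0 < lam.im) (hmu : mu.im < 0)
    {z : ℂ} (hz : 0 < z.im) (h : H) :
    mid ((operator A Γ Γs lam mu).resolventMap z (embed h) : Space H E Es)
      = (A.adjoint.resolventMap z h : H) := by
  have := resolventMap_operator_of_im_pos (lam := lam) (mu := mu) hA hΓ hΓs hlam hmu hz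
    (by simpa using hz) (A.adjoint.resolventMap z h)
  rw [shift_resolventMap (hA.mem_resolventSet_adjoint hz)] at this
  rw [this]
  rfl

theorem adjoint_embed_apply (U : Space H E Es) :
    ContinuousLinearMap.adjoint (embed : H →ₗᵢ[ℂ] Space H E Es).toContinuousLinearMap U = mid U := by
  refine ext_inner_left ℂ fun h => ?_
  rw [ContinuousLinearMap.adjoint_inner_right]
  change inner ℂ (embed h : Space H E Es) U = _
  rw [WithLp.prod_inner_apply, WithLp.prod_inner_apply]
  change inner ℂ (0 : L2 (Iio 0) Es) U.fst
    + (inner ℂ h U.snd.fst + inner ℂ (0 : L2 (Ioi 0) E) U.snd.snd) = inner ℂ h U.snd.fst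
  rw [inner_zero_left, inner_zero_left, zero_add, add_zero]

theorem isSelfadjointDilation_operator (hA : A.IsMaximalDissipative)
    (hΓ : A.IsLagrangeOperator Complex.I Γ)
    (hΓs : A.adjoint.IsLagrangeOperator (-Complex.I) Γs) (hlam : 0 < lam.im) (hmu : mu.im < 0) :
    LinearPMap.IsSelfadjointDilation A embed (operator A Γ Γs lam mu) where
  selfadjoint := isSelfAdjoint_operator hA hΓ hΓs hlam hmu
  mem_resolventSet _ hz :=
    ⟨mem_resolventSet_operator hA hΓ hΓs hlam hmu hz.ne, hA.mem_resolventSet hz⟩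
  compression z hz h := by
    rw [adjoint_embed_apply, mid_resolventMap_operator_of_im_neg hA hΓ hΓs hlam hmu hz]

/-! ### Minimality -/

theorem topologicalClosure_span_resolventMap (hA : A.IsMaximalDissipative)
    (hΓ : A.IsLagrangeOperator Complex.I Γ)
    (hΓs : A.adjoint.IsLagrangeOperator (-Complex.I) Γs) (hlam : 0 < lam.im) (hmu : mu.im < 0) :
    Submodule.topologicalClosure (Submodule.span ℂ
      {W : Space H E Es | ∃ (z : ℂ) (h : H), z.im ≠ 0 ∧
        W = (operator A Γ Γs lam mu).resolventMap z (embed h)}) = ⊤ := by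
  rw [Submodule.topologicalClosure_eq_top_iff, Submodule.eq_bot_iff]
  intro V hV
  have hV' : ∀ (z : ℂ) (h : H), z.im ≠ 0 →
      inner ℂ ((operator A Γ Γs lam mu).resolventMap z (embed h) : Space H E Es) V = 0 := by
    intro z h hz
    refine Submodule.inner_right_of_mem_orthogonal (Submodule.subset_span ?_) hV
    exact ⟨z, h, hz, rfl⟩
  -- A rate `κ` of decay on `(0, ∞)` belongs to `z = -i κ`, and one on `(-∞, 0)` to `z = i κ`.
  have hplus : ∀ (κ : ℂ) (hκ : 0 < κ.re) (x : A.domain),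
      inner ℂ (x : H) V.snd.fst + inner ℂ (expo κ hκ (Complex.I • Γ x)) V.snd.snd = 0 := by
    intro κ hκ x
    have hz : (-(Complex.I * κ)).im < 0 := by simpa using hκ
    have hzκ : Complex.I * -(Complex.I * κ) = κ := by
      rw [mul_neg, ← mul_assoc, Complex.I_mul_I, neg_one_mul, neg_neg]
    have h1 := hV' _ (A.shift (-(Complex.I * κ)) x) hz.ne
    rw [resolventMap_operator_of_im_neg hA hΓ hΓs hlam hmu hz (by rwa [hzκ]) x,
      WithLp.prod_inner_apply, WithLp.prod_inner_apply] at h1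
    change inner ℂ (0 : L2 (Iio 0) Es) V.fst + (inner ℂ (x : H) V.snd.fst
      + inner ℂ (expo (Complex.I * -(Complex.I * κ)) _ (Complex.I • Γ x)) V.snd.snd) = 0 at h1
    rw [inner_zero_left, zero_add] at h1
    simpa only [hzκ] using h1
  have hminus : ∀ (κ : ℂ) (hκ : 0 < κ.re) (y : A.adjoint.domain),
      inner ℂ (expo κ hκ (-(Complex.I • Γs y))) (toPlus V.fst) + inner ℂ (y : H) V.snd.fst = 0 := by
    intro κ hκ y
    have hz : 0 < (Complex.I * κ).im := by simpa using hκ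
    have hzκ : -(Complex.I * (Complex.I * κ)) = κ := by
      rw [← mul_assoc, Complex.I_mul_I, neg_one_mul, neg_neg]
    have h1 := hV' _ (A.adjoint.shift (Complex.I * κ) y) hz.ne'
    rw [resolventMap_operator_of_im_pos hA hΓ hΓs hlam hmu hz (by rwa [hzκ]) y,
      WithLp.prod_inner_apply, WithLp.prod_inner_apply] at h1
    change inner ℂ (toMinus (expo (-(Complex.I * (Complex.I * κ))) _ (-(Complex.I • Γs y)))) V.fst
      + (inner ℂ (y : H) V.snd.fst + inner ℂ (0 : L2 (Ioi 0) E) V.snd.snd) = 0 at h1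
    rw [inner_zero_left, add_zero, ← toMinus_toPlus V.fst, LinearIsometry.inner_map_map] at h1
    simpa only [hzκ] using h1
  have hu : V.snd.fst = 0 := by
    refine hA.1.1.eq_zero_of_inner_right ℂ fun x hx => ?_
    exact eq_zero_of_add_inner_expo_eq_zero fun κ hκ => hplus κ hκ ⟨x, hx⟩
  have hI : Function.Surjective fun e : E => Complex.I • e := fun e =>
    ⟨-(Complex.I • e), by simp [smul_smul]⟩
  have hI' : Function.Surjective fun e : Es => -(Complex.I • e) := fun e =>
    ⟨Complex.I • e, by simp [smul_smul]⟩
  have hp : V.snd.snd = 0 := by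
    refine eq_zero_of_forall_inner_expo_eq_zero
      (hI.denseRange.comp hΓ.denseRange (continuous_const_smul _)) fun κ hκ x => ?_
    have h1 := hplus κ hκ x
    rwa [hu, inner_zero_right, zero_add] at h1
  have hm : toPlus V.fst = 0 := by
    refine eq_zero_of_forall_inner_expo_eq_zero
      (hI'.denseRange.comp hΓs.denseRange (continuous_const_smul _).neg) fun κ hκ y => ?_
    have h1 := hminus κ hκ y
    rwa [hu, inner_zero_right, add_zero] at h1
  have hm' : V.fst = 0 := by rw [← toMinus_toPlus V.fst, hm, (toMinus (F := Es)).map_zero]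
  change WithLp.toLp 2 (V.fst, WithLp.toLp 2 (V.snd.fst, V.snd.snd)) = 0
  rw [hu, hp, hm']
  rfl

theorem isMinimalSelfadjointDilation_operator (hA : A.IsMaximalDissipative)
    (hΓ : A.IsLagrangeOperator Complex.I Γ)
    (hΓs : A.adjoint.IsLagrangeOperator (-Complex.I) Γs) (hlam : 0 < lam.im) (hmu : mu.im < 0) :
    LinearPMap.IsMinimalSelfadjointDilation A embed (operator A Γ Γs lam mu) := by
  refine ⟨isSelfadjointDilation_operator hA hΓ hΓs hlam hmu, fun M _ hM hJ _ => ?_⟩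
  have hcl : IsClosed (M : Set (Space H E Es)) :=
    (completeSpace_coe_iff_isComplete.mp inferInstance).isClosed
  rw [eq_top_iff, ← topologicalClosure_span_resolventMap hA hΓ hΓs hlam hmu]
  refine Submodule.topologicalClosure_minimal _ (Submodule.span_le.mpr ?_) hcl
  rintro _ ⟨z, h, hz, rfl⟩
  exact hM.resolventMap_mem (mem_resolventSet_operator hA hΓ hΓs hlam hmu hz) (hJ h)

end Dilation

theorem theorem7 {H E Es : Type*}
    [NormedAddCommGroup H] [InnerProductSpace ℂ H] [CompleteSpace H]
    [NormedAddCommGroup E] [InnerProductSpace ℂ E] [CompleteSpace E]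
    [NormedAddCommGroup Es] [InnerProductSpace ℂ Es] [CompleteSpace Es]
    (A : H →ₗ.[ℂ] H) (hA : A.IsMaximalDissipative)
    (Γ : A.domain →ₗ[ℂ] E) (hΓ : A.IsLagrangeOperator Complex.I Γ)
    (Γs : A.adjoint.domain →ₗ[ℂ] Es) (hΓs : A.adjoint.IsLagrangeOperator (-Complex.I) Γs)
    (lam mu : ℂ) (hlam : 0 < lam.im) (hmu : mu.im < 0) :
    -- the operator is selfadjoint
    IsSelfAdjoint (Dilation.operator A Γ Γs lam mu) ∧
    -- its two descriptions on the component in `H` agree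
    Dilation.opT A Γ Γs lam mu = Dilation.opTstar A Γ Γs lam mu ∧
    -- it is a minimal selfadjoint dilation of `A`
    A.IsMinimalSelfadjointDilation Dilation.embed (Dilation.operator A Γ Γs lam mu) ∧
    Submodule.topologicalClosure (Submodule.span ℂ
      {W : Dilation.Space H E Es | ∃ (z : ℂ) (h : H), z.im ≠ 0 ∧
        W = (Dilation.operator A Γ Γs lam mu).resolventMap z (Dilation.embed h)}) = ⊤ ∧
    -- the compressed resolvents
    (∀ z : ℂ, z.im < 0 →
      z ∈ (Dilation.operator A Γ Γs lam mu).resolventSet ∧ z ∈ A.resolventSet ∧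
      ∀ h : H, Dilation.mid ((Dilation.operator A Γ Γs lam mu).resolventMap z
        (Dilation.embed h) : Dilation.Space H E Es) = (A.resolventMap z h : H)) ∧
    (∀ z : ℂ, 0 < z.im →
      z ∈ (Dilation.operator A Γ Γs lam mu).resolventSet ∧ z ∈ A.adjoint.resolventSet ∧
      ∀ h : H, Dilation.mid ((Dilation.operator A Γ Γs lam mu).resolventMap z
        (Dilation.embed h) : Dilation.Space H E Es) = (A.adjoint.resolventMap z h : H)) :=
  ⟨Dilation.isSelfAdjoint_operator hA hΓ hΓs hlam hmu,
    Dilation.opT_eq_opTstar hA hΓ hΓs hlam hmu,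
    Dilation.isMinimalSelfadjointDilation_operator hA hΓ hΓs hlam hmu,
    Dilation.topologicalClosure_span_resolventMap hA hΓ hΓs hlam hmu,
    fun _ hz => ⟨Dilation.mem_resolventSet_operator hA hΓ hΓs hlam hmu hz.ne,
      hA.mem_resolventSet hz,
      Dilation.mid_resolventMap_operator_of_im_neg hA hΓ hΓs hlam hmu hz⟩,
    fun _ hz => ⟨Dilation.mem_resolventSet_operator hA hΓ hΓs hlam hmu hz.ne',
      hA.mem_resolventSet_adjoint hz,
      Dilation.mid_resolventMap_operator_of_im_pos hA hΓ hΓs hlam hmu hz⟩⟩
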